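/- Let $\mathfrak a\ge 1$ and $\mathfrak b\ge 0$ be integers, and let $S_1=0$, $S_2=010^{\mathfrak a-1}$, $S_3=010^{\mathfrak a}$, $S_4=10^{\mathfrak a}$, $S_5=10^{\mathfrak a+1}(10^{\mathfrak a})^{\mathfrak b}$, $S_6=10^{\mathfrak a+1}(10^{\mathfrak a})^{\mathfrak b+1}$ be the minimal square roots with parameters $\mathfrak a,\mathfrak b$. If an infinite word $w$ is a product $w=X_1^2X_2^2\cdots$ with every $X_i\in\{S_1,\dots,S_6\}$, its square root is $\sqrt w=X_1X_2\cdots$. Let $S$ be a seed, that is, a primitive word such that - $S=X_1\cdots X_n$ with $n \geq 1$, every $X_i\in\{S_1,\dots,S_6\}$ and $X_1^2\cdots X_n^2=(X_1\cdots X_n)^2$; - $S^2$ is a factor of a Sturmian word of some irrational slope $\alpha=[0;\mathfrak a+1,\mathfrak b+1,\dots]$ (a coding of an orbit of the rotation of the circle by $\alpha$, with letter $1$ on $[1-\alpha,1)$ and $0$ elsewhere, or with letter $1$ on $(1-\alpha,1]$ and $0$ elsewhere); - $|S|>|S_6|$. Let $L(u)$ denote the word $u$ with its first two letters exchanged, put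 $\gamma_1=S$ and $\gamma_{k+1}=L(\gamma_k)\gamma_k^2$ for $k\ge 1$, and let $\Gamma$ be either of the two infinite words $\lim_{k\to\infty}\gamma_{2k}$ and $\lim_{k\to\infty}\gamma_{2k+1}$ (both limits exist). Let $\Omega$ be the subshift generated by $\Gamma$, i.e. the set of infinite words all of whose finite factors are factors of $\Gamma$. Then every $w\in\Omega$ has a well-defined (existing and unique) square root $\sqrt w$, and exactly one of the following holds: $\sqrt w\in\Omega$, or $\sqrt w$ is purely periodic with minimal period conjugate to $S$ (where the minimal period of $v^\omega$ is the primitive root of $v$, and conjugate means cyclically rotated). Moreover, both cases occur: there are $u,v\in\Omega$ such that $\sqrt u\in\Omega$ and $\sqrt v$ is purely periodic with minimal period conjugate to $S$. -/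

import Mathlib

namespace SquareRootMap

/-! ### Words -/

/-- Finite binary words. -/
abbrev Word := List (Fin 2)

/-- Infinite binary words. -/
abbrev InfWord := ℕ → Fin 2

/-- The word `w[i] w[i+1] ⋯ w[i+n-1]`. -/
def factor (w : InfWord) (i n : ℕ) : Word := (List.range n).map fun j => w (i + j)

/-- The language of an infinite word: the set of its (finite) factors. -/
def language (w : InfWord) : Set Word := {u | ∃ i, factor w i u.length = u}

/-- The subshift generated by `w`. -/
def subshift (w : InfWord) : Set InfWord := {x | language x ⊆ language w}

/-- `u` is a prefix of the infinite word `w`. -/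
def IsPrefix (u : Word) (w : InfWord) : Prop := factor w 0 u.length = u

/-- The power `u ^ n`. -/
def wordPow (u : Word) (n : ℕ) : Word := (List.replicate n u).flatten

/-- `w` is primitive: `w = z ^ n` only for `n = 1`. In particular the empty word is not primitive. -/
def Primitive (w : Word) : Prop := ∀ (z : Word) (n : ℕ), w = wordPow z n → n = 1

/-- `w` is the infinite product `X 0 · X 1 · X 2 ⋯` of nonempty words. -/
def IsInfProd (X : ℕ → Word) (w : InfWord) : Prop :=
  (∀ n, X n ≠ []) ∧ ∀ n, IsPrefix ((List.range n).map X).flatten w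

/-- `z` is the minimal period of the purely periodic word `w`: `w = v ^ ω` for a nonempty word `v`
whose primitive root is `z`. -/
def IsMinimalPeriod (w : InfWord) (z : Word) : Prop :=
  ∃ v : Word, IsInfProd (fun _ => v) w ∧ Primitive z ∧ ∃ n, 1 ≤ n ∧ v = wordPow z n

/-- The infinite word `w` is the limit of the sequence `u` of finite words: for every `n`, all but
finitely many of the `u k` have the prefix of `w` of length `n` as a prefix. -/
def IsWordLimit (u : ℕ → Word) (w : InfWord) : Prop :=
  ∀ n, ∃ K, ∀ k, K ≤ k → factor w 0 n <+: u k

/-! ### Minimal squares and square roots -/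

/-- `S₆ = 1 0^(a+1) (1 0^a)^(b+1)`. -/
def root6 (a b : ℕ) : Word :=
  1 :: List.replicate (a + 1) 0 ++ wordPow (1 :: List.replicate a 0) (b + 1)

/-- The six minimal square roots `S₁, …, S₆` with parameters `a ≥ 1` and `b ≥ 0`. -/
def minRoots (a b : ℕ) : List Word :=
  [ [0],
    0 :: 1 :: List.replicate (a - 1) 0,
    0 :: 1 :: List.replicate a 0,
    1 :: List.replicate a 0,
    1 :: List.replicate (a + 1) 0 ++ wordPow (1 :: List.replicate a 0) b,
    root6 a b ]

/-- `r = √w`: for some minimal square roots `X 0, X 1, …` the word `w` is the product of the squares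
`(X 0)² (X 1)² ⋯` and `r` is the product `X 0 · X 1 ⋯`. -/
def IsSqrt (a b : ℕ) (w r : InfWord) : Prop :=
  ∃ X : ℕ → Word, (∀ n, X n ∈ minRoots a b) ∧
    IsInfProd (fun n => X n ++ X n) w ∧ IsInfProd X r

/-- `w` is a solution of `X₁² ⋯ Xₙ² = (X₁ ⋯ Xₙ)²` in minimal square roots. -/
def IsSolution (a b : ℕ) (w : Word) : Prop :=
  w ≠ [] ∧ ∃ X : List Word, (∀ x ∈ X, x ∈ minRoots a b) ∧ w = X.flatten ∧
    (X.map fun x => x ++ x).flatten = X.flatten ++ X.flatten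

/-! ### Sturmian words -/

/-- `s` is a Sturmian word of slope `α` (for irrational `α ∈ (0,1)`): the coding of the orbit of a
point `x` under the rotation by `α` of the circle, with letter `1` for the interval `[1 - α, 1)` or,
in the other convention, for the interval `(1 - α, 1]`. The representative of `y` modulo `1` in
`(0,1]` is `1 - Int.fract (-y)`. -/
def IsSturmian (α : ℝ) (s : InfWord) : Prop :=
  ∃ x : ℝ, (∀ n : ℕ, s n = 1 ↔ 1 - α ≤ Int.fract (x + n * α)) ∨
    (∀ n : ℕ, s n = 1 ↔ 1 - α < 1 - Int.fract (-(x + n * α)))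

/-- `α` is irrational with continued fraction expansion `[0; a + 1, b + 1, …]`. -/
def IsSlope (a b : ℕ) (α : ℝ) : Prop :=
  Irrational α ∧ (GenContFract.of α).h = 0 ∧
    (GenContFract.of α).partDens.get? 0 = some ((a : ℝ) + 1) ∧
    (GenContFract.of α).partDens.get? 1 = some ((b : ℝ) + 1)

/-! ### The words `Γ` -/

/-- `S` is a seed: a primitive solution with `S²` in the language of a Sturmian word of some slope
`[0; a + 1, b + 1, …]`, and `|S| > |S₆|`. -/
def IsSeed (a b : ℕ) (S : Word) : Prop :=
  Primitive S ∧ IsSolution a b S ∧ (root6 a b).length < S.length ∧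
    ∃ (α : ℝ) (s : InfWord), IsSlope a b α ∧ IsSturmian α s ∧ S ++ S ∈ language s

/-- The operation `L` that exchanges the first two letters of a word. -/
def swap : Word → Word
  | x :: y :: t => y :: x :: t
  | t => t

/-- The sequence `γ₁ = S`, `γₖ₊₁ = L(γₖ) γₖ²`; here `gammaSeq S k` is `γₖ₊₁`. -/
def gammaSeq (S : Word) : ℕ → Word
  | 0 => S
  | k + 1 => swap (gammaSeq S k) ++ gammaSeq S k ++ gammaSeq S k

/-- `Γ` is one of the two words `Γ₁ = lim γ₂ₖ` and `Γ₂ = lim γ₂ₖ₊₁`. -/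
def IsGamma (S : Word) (Γ : InfWord) : Prop :=
  IsWordLimit (fun k => gammaSeq S (2 * k + 1)) Γ ∨ IsWordLimit (fun k => gammaSeq S (2 * k)) Γ

theorem two_le_length_gammaSeq {S : Word} (hS : 2 ≤ S.length) (k : ℕ) :
    k + 2 ≤ (gammaSeq S k).length := by
  induction k with
  | zero => exact hS
  | succ k ih => simp only [gammaSeq, List.length_append]; omega

theorem gammaSeq_prefix {S : Word} (hS : 2 ≤ S.length) (k : ℕ) :
    gammaSeq S k <+: gammaSeq S (k + 2) := by
  have h := two_le_length_gammaSeq hS k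
  simp only [gammaSeq]
  match gammaSeq S k, h with
  | x :: y :: t, _ => simp [swap]

/-- Both limits exist. -/
theorem exists_limit {S : Word} (hS : 2 ≤ S.length) (e : ℕ) :
    ∃ Γ, IsWordLimit (fun k => gammaSeq S (2 * k + e)) Γ := by
  have hm : ∀ i j, i ≤ j → gammaSeq S (2 * i + e) <+: gammaSeq S (2 * j + e) := by
    intro i j hij
    induction j, hij using Nat.le_induction with
    | base => exact List.prefix_rfl
    | succ j _ ih =>
      refine ih.trans ?_
      rw [show 2 * (j + 1) + e = 2 * j + e + 2 by ring]
      exact gammaSeq_prefix hS _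
  refine ⟨fun n => (gammaSeq S (2 * n + e)).getD n 0, fun n => ⟨n, fun k hk => ?_⟩⟩
  have hl := two_le_length_gammaSeq hS
  rw [List.prefix_iff_getElem]
  have hk' := hl (2 * k + e)
  refine ⟨by simp [factor]; omega, fun i hi => ?_⟩
  have hi' : i < n := by simpa [factor] using hi
  have hi2 : i < (gammaSeq S (2 * i + e)).length := by have := hl (2 * i + e); omega
  have := (hm i k (by omega)).getElem hi2
  simp [factor, List.getElem?_eq_getElem hi2, this]

end SquareRootMap

/-! Let `P` and `R` be the numbers of ones and zeros of the seed `S`, and `q = P + R = |S|`. Words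
are read by a walk on the integers of `[-R, P]`: a `0` moves by `+P` and may be read at points `≤
0`, a `1` moves by `-R` and may be read at points `≥ 0`. This is the rotation by `P / q`; only at
the point `0` are both letters allowed. `S` and `L(S)` are both closed walks from `0`, so every word
of `Ω` is read from some state `z`, and `Γ` stands at `0` exactly at the multiples of `q`.

Taking square roots halves the state: if a product of squares of minimal roots is read from `z`, the
product of the roots is read from `z / 2` (`Reads.half`, `IsSqrt.infReads`). This is expressed
integrally by keeping `z` and doubling the steps. The parity of `z` then decides between the two
cases.

If `z` is odd, the halved walk never meets `0`, so every letter is forced and the root is a coding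
of a rational rotation. It is a shift of `S^ω`, because `S` itself is read from `1/2` or `-1/2`
(`IsSeed.exists_seedData`). If `z` is even, `w` occurs in `Γ` at positions `2k` where the state of
`Γ` at `k` is `z / 2` (`OccursAt.exists_even`), so the root walks along with `Γ` from `k`, and only
letters read at `0` are in doubt. There the `l`-th letter of the root is `w (2l)`
(`IsSqrt.letter_of_disp_eq_zero`), and `Γ (2qm) = Γ (qm)` since the letter of `Γ` at `qm` depends
only on the parity of the 3-adic valuation of `m`. The cases exclude each other because this
dependence rules out the period `q` in `Ω`.

Square roots exist and are unique because, with `c = R - aP`, the inequalities `(b+1)c < P < (b+2)c`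
force the arrangement of the blocks `1 0^a` and `1 0^(a+1)`. They follow from the slope and from
`|S| > |S₆|`. -/

namespace SquareRootMap

/-! ### Factors and infinite products -/

/-- The infinite word `w` without its first `k` letters. -/
def shift (k : ℕ) (w : InfWord) : InfWord := fun n => w (k + n)

theorem shift_apply (k : ℕ) (w : InfWord) (n : ℕ) : shift k w n = w (k + n) := rfl

theorem shift_shift (j k : ℕ) (w : InfWord) : shift j (shift k w) = shift (k + j) w := by
  funext n; simp [shift, add_assoc]

@[simp] theorem shift_zero (w : InfWord) : shift 0 w = w := by
  funext n; simp [shift]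

@[simp] theorem length_factor (w : InfWord) (i n : ℕ) : (factor w i n).length = n := by
  simp [factor]

@[simp] theorem getElem_factor (w : InfWord) (i n j : ℕ) (h : j < (factor w i n).length) :
    (factor w i n)[j] = w (i + j) := by
  simp [factor]

theorem factor_add (w : InfWord) (i m n : ℕ) :
    factor w i (m + n) = factor w i m ++ factor w (i + m) n := by
  simp [factor, List.range_add, Function.comp_def, add_assoc]

theorem factor_succ (w : InfWord) (i n : ℕ) : factor w i (n + 1) = factor w i n ++ [w (i + n)] := by
  rw [factor_add]; simp [factor]

theorem factor_shift (w : InfWord) (k i n : ℕ) : factor (shift k w) i n = factor w (k + i) n := by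
  simp [factor, shift, add_assoc]

theorem factor_congr {v w : InfWord} {i j n : ℕ} (h : ∀ k < n, v (i + k) = w (j + k)) :
    factor v i n = factor w j n := by
  simpa [factor] using h

theorem factor_eq_iff {v w : InfWord} {i j n : ℕ} :
    factor v i n = factor w j n ↔ ∀ k < n, v (i + k) = w (j + k) := by
  simp [factor]

theorem isPrefix_iff {u : Word} {w : InfWord} :
    IsPrefix u w ↔ ∀ (i : ℕ) (h : i < u.length), w i = u[i] := by
  unfold IsPrefix
  constructor
  · intro h i hi
    have : (factor w 0 u.length)[i]'(by simpa using hi) = u[i] := by simp only [h]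
    simpa using this
  · intro h
    refine List.ext_getElem (by simp) fun i h1 h2 => ?_
    simp [h i h2]

theorem isPrefix_append {u v : Word} {w : InfWord} :
    IsPrefix (u ++ v) w ↔ IsPrefix u w ∧ IsPrefix v (shift u.length w) := by
  unfold IsPrefix
  rw [List.length_append, factor_add, factor_shift, zero_add, add_zero]
  constructor
  · intro h
    exact List.append_inj h (by simp)
  · rintro ⟨h1, h2⟩
    rw [h1, h2]

theorem isPrefix_nil {w : InfWord} : IsPrefix [] w := by simp [IsPrefix, factor]

theorem isPrefix_cons {x : Fin 2} {u : Word} {w : InfWord} :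
    IsPrefix (x :: u) w ↔ w 0 = x ∧ IsPrefix u (shift 1 w) := by
  rw [← List.singleton_append, isPrefix_append]
  simp [IsPrefix, factor]

theorem isPrefix_replicate {n : ℕ} {x : Fin 2} {w : InfWord} :
    IsPrefix (List.replicate n x) w ↔ ∀ i < n, w i = x := by
  simp [isPrefix_iff]

theorem wordPow_zero (u : Word) : wordPow u 0 = [] := by simp [wordPow]

theorem wordPow_succ (u : Word) (n : ℕ) : wordPow u (n + 1) = u ++ wordPow u n := by
  simp [wordPow, List.replicate_succ]

theorem length_wordPow (u : Word) (n : ℕ) : (wordPow u n).length = n * u.length := by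
  simp [wordPow]

theorem getD_wordPow (u : Word) (n i : ℕ) (h : i < n * u.length) :
    (wordPow u n).getD i 0 = u.getD (i % u.length) 0 := by
  induction n generalizing i with
  | zero => simp at h
  | succ n ih =>
    rw [wordPow_succ]
    by_cases hi : i < u.length
    · rw [List.getD_append _ _ _ _ hi, Nat.mod_eq_of_lt hi]
    · push Not at hi
      rw [List.getD_append_right _ _ _ _ hi, ih _ (by rw [add_mul] at h; omega),
        ← Nat.mod_eq_sub_mod hi]

/-- The product of the first `k` words of the sequence `X`. -/
def partialProd (X : ℕ → Word) (k : ℕ) : Word := ((List.range k).map X).flatten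

@[simp] theorem partialProd_zero (X : ℕ → Word) : partialProd X 0 = [] := by simp [partialProd]

theorem partialProd_succ (X : ℕ → Word) (k : ℕ) :
    partialProd X (k + 1) = partialProd X k ++ X k := by
  simp [partialProd, List.range_succ]

theorem le_length_partialProd {X : ℕ → Word} (hX : ∀ n, X n ≠ []) (k : ℕ) :
    k ≤ (partialProd X k).length := by
  induction k with
  | zero => simp
  | succ k ih =>
    have := List.length_pos_of_ne_nil (hX k)
    rw [partialProd_succ, List.length_append]; omega

theorem length_partialProd_sq (X : ℕ → Word) (k : ℕ) :
    (partialProd (fun n => X n ++ X n) k).length = 2 * (partialProd X k).length := by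
  induction k with
  | zero => simp
  | succ k ih => simp only [partialProd_succ, List.length_append, ih]; ring

theorem exists_position {X : ℕ → Word} (hX : ∀ n, X n ≠ []) (l : ℕ) :
    ∃ k j, j < (X k).length ∧ l = (partialProd X k).length + j := by
  have hp := fun k => List.length_pos_of_ne_nil (hX k)
  induction l with
  | zero => exact ⟨0, 0, hp 0, by simp⟩
  | succ l ih =>
    obtain ⟨k, j, hj, rfl⟩ := ih
    by_cases h : j + 1 < (X k).length
    · exact ⟨k, j + 1, h, by ring⟩
    · exact ⟨k + 1, 0, hp _, by rw [partialProd_succ, List.length_append]; omega⟩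

theorem IsInfProd.isPrefix {X : ℕ → Word} {w : InfWord} (h : IsInfProd X w) (k : ℕ) :
    IsPrefix (partialProd X k) w := h.2 k

theorem IsInfProd.isPrefix_shift {X : ℕ → Word} {w : InfWord} (h : IsInfProd X w) (k : ℕ) :
    IsPrefix (X k) (shift (partialProd X k).length w) := by
  have := h.isPrefix (k + 1)
  rw [partialProd_succ, isPrefix_append] at this
  exact this.2

theorem IsInfProd.unique {X : ℕ → Word} {v w : InfWord} (hv : IsInfProd X v)
    (hw : IsInfProd X w) : v = w := by
  funext n
  have hn := le_length_partialProd hv.1 (n + 1)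
  rw [isPrefix_iff.1 (hv.isPrefix (n + 1)) n (by omega),
    isPrefix_iff.1 (hw.isPrefix (n + 1)) n (by omega)]

theorem isInfProd_of_isPrefix_shift {X : ℕ → Word} {w : InfWord} (hX : ∀ n, X n ≠ [])
    (h : ∀ k, IsPrefix (X k) (shift (partialProd X k).length w)) : IsInfProd X w := by
  refine ⟨hX, fun k => ?_⟩
  change IsPrefix (partialProd X k) w
  induction k with
  | zero => simpa using isPrefix_nil
  | succ k ih => rw [partialProd_succ, isPrefix_append]; exact ⟨ih, h k⟩

theorem exists_isInfProd {X : ℕ → Word} (hX : ∀ n, X n ≠ []) : ∃ w, IsInfProd X w := by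
  have hmono : ∀ i j, i ≤ j → partialProd X i <+: partialProd X j := by
    intro i j hij
    induction j, hij using Nat.le_induction with
    | base => exact List.prefix_rfl
    | succ j _ ih => rw [partialProd_succ]; exact ih.trans (List.prefix_append _ _)
  refine ⟨fun n => (partialProd X (n + 1)).getD n 0, hX, fun k => ?_⟩
  change IsPrefix (partialProd X k) _
  rw [isPrefix_iff]
  intro i hi
  have hi' := le_length_partialProd hX (i + 1)
  have h1 : i < (partialProd X (i + 1)).length := by omega
  simp only [List.getD_eq_getElem _ _ h1]
  rcases le_total (i + 1) k with h | h
  · exact (hmono _ _ h).getElem h1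
  · exact ((hmono _ _ h).getElem hi).symm

theorem fin_two_cases (x : Fin 2) : x = 0 ∨ x = 1 := by omega

/-! ### Reading words along a rotation -/

/-- The displacement of a letter under the interval exchange that moves a point by `P` when it reads
`0` and by `-R` when it reads `1`. -/
def step (P R : ℤ) (x : Fin 2) : ℤ := if x = 0 then P else -R

@[simp] theorem step_zero (P R : ℤ) : step P R 0 = P := rfl

@[simp] theorem step_one (P R : ℤ) : step P R 1 = -R := rfl

/-- The displacement of a word. -/
def disp (P R : ℤ) (u : Word) : ℤ := (u.map (step P R)).sum

/-- Starting at `z`, the word `u` can be read so that `0` is only read at points `≤ hi` and `1` only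
at points `≥ lo`. -/
def Tol (P R lo hi : ℤ) : ℤ → Word → Prop
  | _, [] => True
  | z, x :: u => (x = 0 → z ≤ hi) ∧ (x = 1 → lo ≤ z) ∧ Tol P R lo hi (z + step P R x) u

/-- Starting at `z`, the word `u` can be read so that `0` is only read at nonpositive points and `1`
only at nonnegative points. -/
abbrev Reads (P R : ℤ) : ℤ → Word → Prop := Tol P R 0 0

section
variable {P R lo hi z : ℤ}

@[simp] theorem disp_nil : disp P R [] = 0 := rfl

@[simp] theorem disp_cons (x : Fin 2) (u : Word) : disp P R (x :: u) = step P R x + disp P R u := by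
  simp [disp]

@[simp] theorem disp_append (u v : Word) : disp P R (u ++ v) = disp P R u + disp P R v := by
  simp [disp]

theorem disp_replicate (n : ℕ) (x : Fin 2) : disp P R (List.replicate n x) = n * step P R x := by
  simp [disp]

theorem disp_wordPow (u : Word) (n : ℕ) : disp P R (wordPow u n) = n * disp P R u := by
  induction n with
  | zero => simp [wordPow_zero]
  | succ n ih => rw [wordPow_succ, disp_append, ih]; push_cast; ring

theorem disp_double (u : Word) : disp (2 * P) (2 * R) u = 2 * disp P R u := by
  induction u with
  | nil => simp
  | cons x u ih =>
    rcases fin_two_cases x with rfl | rfl <;> simp [ih] <;> ring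

theorem disp_eq (u : Word) : disp P R u = P * u.length - (P + R) * u.count 1 := by
  induction u with
  | nil => simp
  | cons x u ih =>
    rcases fin_two_cases x with rfl | rfl <;> simp [ih] <;> ring

theorem disp_modEq (u : Word) : disp P R u ≡ P * u.length [ZMOD P + R] := by
  rw [disp_eq]
  exact (Int.modEq_iff_dvd.2 ⟨u.count 1, by ring⟩)

theorem tol_append {u v : Word} :
    Tol P R lo hi z (u ++ v) ↔ Tol P R lo hi z u ∧ Tol P R lo hi (z + disp P R u) v := by
  induction u generalizing z with
  | nil => simp [Tol]
  | cons x u ih => simp [Tol, ih, and_assoc, add_assoc]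

theorem Tol.of_prefix {u v : Word} (h : Tol P R lo hi z v) (huv : u <+: v) :
    Tol P R lo hi z u := by
  obtain ⟨t, rfl⟩ := huv
  exact (tol_append.1 h).1

theorem tol_iff {u : Word} : Tol P R lo hi z u ↔ ∀ (i : ℕ) (h : i < u.length),
    (u[i] = 0 → z + disp P R (u.take i) ≤ hi) ∧ (u[i] = 1 → lo ≤ z + disp P R (u.take i)) := by
  induction u generalizing z with
  | nil => simp [Tol]
  | cons x u ih =>
    simp only [Tol, ih]
    constructor
    · rintro ⟨h1, h2, h3⟩ i hi
      rcases i with _ | i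
      · simpa using ⟨h1, h2⟩
      · simpa [add_assoc] using h3 i (by simpa using hi)
    · intro h
      have h0 := h 0 (by simp)
      refine ⟨by simpa using h0.1, by simpa using h0.2, fun i hi => ?_⟩
      have := h (i + 1) (by simpa using hi)
      simpa only [List.getElem_cons_succ, List.take_succ_cons, disp_cons, add_assoc] using this

theorem reads_append {u v : Word} :
    Reads P R z (u ++ v) ↔ Reads P R z u ∧ Reads P R (z + disp P R u) v := tol_append

theorem Reads.of_prefix {u v : Word} (h : Reads P R z v) (huv : u <+: v) : Reads P R z u :=
  Tol.of_prefix h huv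

theorem reads_iff {u : Word} : Reads P R z u ↔ ∀ (i : ℕ) (h : i < u.length),
    (u[i] = 0 → z + disp P R (u.take i) ≤ 0) ∧ (u[i] = 1 → 0 ≤ z + disp P R (u.take i)) := tol_iff

theorem Reads.mem_range {u : Word} (h : Reads P R z u) (hz : -R ≤ z) (hz' : z ≤ P) (hP : 0 ≤ P)
    (hR : 0 ≤ R) : -R ≤ z + disp P R u ∧ z + disp P R u ≤ P := by
  induction u generalizing z with
  | nil => simpa using ⟨hz, hz'⟩
  | cons x u ih =>
    obtain ⟨h1, h2, h3⟩ := h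
    rcases fin_two_cases x with rfl | rfl
    · have := h1 rfl
      simpa [add_assoc] using ih h3 (by simp; omega) (by simp; omega)
    · have := h2 rfl
      simpa [add_assoc] using ih h3 (by simp; omega) (by simp; omega)

/-- If a square `X ^ 2` is read from `z`, then its root is read from `z / 2`. -/
theorem Reads.half {X : Word} (hX : Tol P R (min 0 (disp P R X)) (max 0 (disp P R X)) 0 X)
    (h : Reads P R z (X ++ X)) : Reads (2 * P) (2 * R) z X := by
  obtain ⟨h1, h2⟩ := reads_append.1 h
  rw [reads_iff] at h1 h2 ⊢
  rw [tol_iff] at hX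
  -- Let `e` be the displacement of the prefix before index `i` and `d` that of `X`. A letter `0`
  -- gives `z + e ≤ 0`, `z + d + e ≤ 0` and `e ≤ max 0 d`, hence `z + 2e ≤ 0`; a letter `1` is
  -- symmetric.
  intro i hi
  have h1 := h1 i hi
  have h2 := h2 i hi
  have hX := hX i hi
  rw [disp_double]
  refine ⟨fun h0 => ?_, fun h0 => ?_⟩
  · have := h1.1 h0
    have := h2.1 h0
    have := hX.1 h0
    omega
  · have := h1.2 h0
    have := h2.2 h0
    have := hX.2 h0
    omega

theorem Reads.half_flatten {X : List Word}
    (hX : ∀ x ∈ X, Tol P R (min 0 (disp P R x)) (max 0 (disp P R x)) 0 x)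
    (h : Reads P R z (X.map fun x => x ++ x).flatten) : Reads (2 * P) (2 * R) z X.flatten := by
  induction X generalizing z with
  | nil => simp [Tol]
  | cons x X ih =>
    rw [List.map_cons, List.flatten_cons, reads_append] at h
    rw [List.flatten_cons, reads_append]
    refine ⟨h.1.half (hX x (by simp)), ih (fun y hy => hX y (by simp [hy])) ?_⟩
    convert h.2 using 1
    rw [disp_double, disp_append]; ring

theorem tol_replicate_zero {n : ℕ} (hP : 0 ≤ P) (h : n ≠ 0 → z + (n - 1) * P ≤ hi) :
    Tol P R lo hi z (List.replicate n 0) := by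
  rw [tol_iff]
  intro i hi
  have hi' : i < n := by simpa using hi
  simp only [List.getElem_replicate, List.take_replicate, disp_replicate]
  refine ⟨fun _ => ?_, by simp⟩
  have := h (by omega)
  have : ((min i n : ℕ) : ℤ) ≤ n - 1 := by omega
  rw [step_zero]
  nlinarith

/-- Every minimal square root is read from `0` with tolerance its own displacement. -/
theorem tol_of_mem_minRoots {a b : ℕ} (hP : 0 < P) (h1 : a * P ≤ R) (h2 : R ≤ (a + 1) * P)
    (ha : 1 ≤ a) {X : Word} (hX : X ∈ minRoots a b) :
    Tol P R (min 0 (disp P R X)) (max 0 (disp P R X)) 0 X := by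
  have key : ∀ n : ℕ, Tol P R (min 0 (disp P R (1 :: List.replicate (a + 1) 0 ++
      wordPow (1 :: List.replicate a 0) n))) (max 0 (disp P R (1 :: List.replicate (a + 1) 0 ++
      wordPow (1 :: List.replicate a 0) n))) 0 (1 :: List.replicate (a + 1) 0 ++
      wordPow (1 :: List.replicate a 0) n) := by
    intro n
    -- Each block `1 0^a` lowers the walk or keeps it level, so the lowest `1` opens the last block;
    -- its zeros stay at points `≤ 0` since `s ≤ P`.
    have main : ∀ (lo hi s : ℤ) (n : ℕ), 0 ≤ hi → s ≤ P → (n ≠ 0 → lo ≤ s + (n - 1) * (a * P - R)) →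
        Tol P R lo hi s (wordPow (1 :: List.replicate a 0) n) := by
      intro lo hi s n hhi
      induction n generalizing s with
      | zero => simp [wordPow_zero, Tol]
      | succ n ih =>
        intro hs hlo
        have hlo := hlo (by omega)
        push_cast at hlo
        rw [wordPow_succ, tol_append]
        refine ⟨⟨by simp, fun _ => ?_, ?_⟩, ?_⟩
        · nlinarith
        · refine tol_replicate_zero hP.le fun _ => ?_
          rw [step_one]; nlinarith
        · simp only [disp_cons, step_one, disp_replicate, step_zero]
          refine ih _ (by nlinarith) fun hn => ?_
          nlinarith
    rw [tol_append]
    refine ⟨⟨by simp, fun _ => by simp, ?_⟩, ?_⟩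
    · refine tol_replicate_zero hP.le fun _ => ?_
      push_cast
      rw [step_one]
      refine le_trans ?_ (le_max_left _ _)
      nlinarith
    · refine main _ _ _ _ (le_max_left _ _) ?_ fun _ => ?_
      · simp only [disp_cons, step_one, disp_replicate, step_zero]
        push_cast; nlinarith
      · refine le_trans (min_le_right _ _) ?_
        simp only [disp_append, disp_wordPow, disp_cons, step_one, disp_replicate, step_zero]
        push_cast; nlinarith
  obtain ⟨a, rfl⟩ := Nat.exists_eq_add_of_le' ha
  simp only [minRoots, List.mem_cons, List.not_mem_nil, or_false] at hX
  push_cast at h1 h2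
  rcases hX with rfl | rfl | rfl | rfl | rfl | rfl
  · simp [Tol]
  · refine ⟨by simp, by simp, by simp, ?_, ?_⟩
    · simp [hP.le]
    · refine tol_replicate_zero hP.le fun _ => le_trans ?_ (le_max_left _ _)
      simp; nlinarith
  · refine ⟨by simp, by simp, by simp, ?_, ?_⟩
    · simp [hP.le]
    · refine tol_replicate_zero hP.le fun _ => le_trans ?_ (le_max_left _ _)
      simp; nlinarith
  · refine ⟨by simp, by simp, ?_⟩
    refine tol_replicate_zero hP.le fun _ => le_trans ?_ (le_max_left _ _)
    simp; nlinarith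
  · exact key b
  · exact key (b + 1)

end

theorem ne_nil_of_mem_minRoots {a b : ℕ} {X : Word} (hX : X ∈ minRoots a b) : X ≠ [] := by
  simp only [minRoots, root6, List.mem_cons, List.not_mem_nil, or_false] at hX
  rcases hX with rfl | rfl | rfl | rfl | rfl | rfl <;> simp

theorem length_root6 (a b : ℕ) : (root6 a b).length = (a + 1) * (b + 2) + 1 := by
  simp [root6, length_wordPow]; ring

theorem length_le_of_mem_minRoots {a b : ℕ} {X : Word} (ha : 1 ≤ a) (hX : X ∈ minRoots a b) :
    X.length ≤ (root6 a b).length := by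
  rw [length_root6]
  simp only [minRoots, root6, List.mem_cons, List.not_mem_nil, or_false] at hX
  rcases hX with rfl | rfl | rfl | rfl | rfl | rfl <;> simp [length_wordPow] <;>
    first | omega | nlinarith | exact lt_of_le_of_lt (Nat.sub_le _ _) (by nlinarith)

/-! ### Reading infinite words and existence of square roots -/

/-- Starting at `z`, the infinite word `w` can be read. -/
def InfReads (P R z : ℤ) (w : InfWord) : Prop := ∀ n, Reads P R z (factor w 0 n)

theorem wordPow_succ' (u : Word) (n : ℕ) : wordPow u (n + 1) = wordPow u n ++ u := by
  simp [wordPow, List.replicate_succ']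

section
variable {P R z : ℤ} {w : InfWord}

theorem InfReads.suffix (h : InfReads P R z w) (k : ℕ) :
    InfReads P R (z + disp P R (factor w 0 k)) (shift k w) := by
  intro n
  have := h (k + n)
  rw [factor_add, reads_append] at this
  rw [factor_shift]
  simpa [add_comm] using this.2

theorem InfReads.of_isPrefix (h : InfReads P R z w) {u : Word} (hu : IsPrefix u w) :
    InfReads P R (z + disp P R u) (shift u.length w) := by
  have := h.suffix u.length
  rwa [hu] at this

theorem InfReads.reads (h : InfReads P R z w) {u : Word} (hu : IsPrefix u w) : Reads P R z u := by
  have := h u.length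
  rwa [hu] at this

theorem InfReads.letter (h : InfReads P R z w) (n : ℕ) :
    (w n = 0 → z + disp P R (factor w 0 n) ≤ 0) ∧ (w n = 1 → 0 ≤ z + disp P R (factor w 0 n)) := by
  have := h (n + 1)
  rw [factor_succ, reads_append] at this
  simpa [Tol] using this.2

theorem InfReads.letter_zero (h : InfReads P R z w) : (w 0 = 0 → z ≤ 0) ∧ (w 0 = 1 → 0 ≤ z) := by
  simpa [factor] using h.letter 0

theorem InfReads.isPrefix_zeros (h : InfReads P R z w) {n : ℕ} (hP : 0 ≤ P)
    (hn : z + (n - 1) * P < 0) : IsPrefix (List.replicate n 0) w := by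
  induction n with
  | zero => simp [isPrefix_nil]
  | succ n ih =>
    push_cast at hn
    have h1 := ih (by nlinarith)
    rw [List.replicate_succ', isPrefix_append]
    refine ⟨h1, ?_⟩
    have h2 := (h.of_isPrefix h1).letter_zero
    rw [disp_replicate, step_zero] at h2
    rw [isPrefix_cons]
    refine ⟨?_, isPrefix_nil⟩
    rcases fin_two_cases (shift (List.replicate n (0 : Fin 2)).length w 0) with h0 | h0
    · exact h0
    · have := h2.2 h0
      linarith

end

/-! ### Forced blocks and the six minimal squares -/

section
variable {P R c z : ℤ} {w : InfWord} {a b : ℕ}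

/-- The zeros are forced: the last of them is read at `z - P - c < 0`. The block as a whole moves
the walk by `aP - R = -c`. -/
theorem InfReads.short_block (h : InfReads P R z w) (hR : R = a * P + c) (hP : 0 < P) (hc : 0 < c)
    (h0 : w 0 = 1) (hz : z ≤ P) :
    IsPrefix (1 :: List.replicate a 0) w ∧ InfReads P R (z - c) (shift (a + 1) w) := by
  have h1 : IsPrefix [1] w := isPrefix_cons.2 ⟨h0, isPrefix_nil⟩
  have h2 : IsPrefix (1 :: List.replicate a 0) w := by
    rw [isPrefix_cons]
    refine ⟨h0, (h.of_isPrefix h1).isPrefix_zeros hP.le ?_⟩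
    simp; nlinarith
  refine ⟨h2, ?_⟩
  convert h.of_isPrefix h2 using 2
  · simp [disp_replicate, hR]; ring
  · simp

/-- The extra zero is read at `z - c`, whence `z ≤ c`. It leads to `z - c + P > 0`, where only a `1`
can follow. -/
theorem InfReads.long_block (h : InfReads P R z w) (hR : R = a * P + c) (hP : 0 < P) (hc : 0 < c)
    (hcP : c < P) (h0 : w 0 = 1) (hz : z ≤ P) (ha : w (a + 1) = 0) :
    IsPrefix (1 :: List.replicate (a + 1) 0) w ∧ z ≤ c ∧
      InfReads P R (z - c + P) (shift (a + 2) w) ∧ w (a + 2) = 1 := by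
  obtain ⟨h1, h2⟩ := h.short_block hR hP hc h0 hz
  have hz0 := h.letter_zero.2 h0
  have hzc := h2.letter_zero.1 (by simpa [shift] using ha)
  have h3 : IsPrefix (1 :: List.replicate (a + 1) 0) w := by
    rw [List.replicate_succ', ← List.cons_append, isPrefix_append]
    refine ⟨h1, isPrefix_cons.2 ⟨?_, isPrefix_nil⟩⟩
    simpa [shift] using ha
  have h4 : InfReads P R (z - c + P) (shift (a + 2) w) := by
    convert h.of_isPrefix h3 using 1
    · simp only [disp_cons, disp_replicate, step_one, step_zero, hR]
      push_cast; ring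
    · simp
  refine ⟨h3, by omega, h4, ?_⟩
  have h5 := h4.letter_zero.1
  rw [shift_apply, add_zero] at h5
  rcases fin_two_cases (w (a + 2)) with h6 | h6
  · have := h5 h6
    omega
  · exact h6

theorem InfReads.short_blocks (h : InfReads P R z w) (hR : R = a * P + c) (hP : 0 < P) (hc : 0 < c)
    (h0 : w 0 = 1) (hz : z ≤ P) {n : ℕ} (hn : 0 < z - n * c) :
    IsPrefix (wordPow (1 :: List.replicate a 0) n) w ∧
      InfReads P R (z - n * c) (shift (n * (a + 1)) w) ∧ w (n * (a + 1)) = 1 := by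
  induction n with
  | zero => simpa [wordPow_zero, isPrefix_nil] using ⟨h, h0⟩
  | succ n ih =>
    push_cast at hn
    obtain ⟨h1, h2, h3⟩ := ih (by linarith)
    obtain ⟨h4, h5⟩ := h2.short_block hR hP hc (by simpa [shift_apply] using h3)
      (by nlinarith [Int.natCast_nonneg n])
    have h6 : n * (a + 1) + (a + 1) = (n + 1) * (a + 1) := by ring
    rw [shift_shift, h6] at h5
    have h7 := h5.letter_zero.1
    rw [shift_apply, add_zero] at h7
    refine ⟨?_, ?_, ?_⟩
    · rw [wordPow_succ', isPrefix_append]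
      exact ⟨h1, by simpa [length_wordPow] using h4⟩
    · convert h5 using 1
      push_cast; ring
    · rcases fin_two_cases (w ((n + 1) * (a + 1))) with h8 | h8
      · have := h7 h8
        linarith
      · exact h8

/-- Since `(b+1)c < P`, the walk stays positive through `b` short blocks after a long one, so all of
them are forced. -/
theorem InfReads.long_run (h : InfReads P R z w) (hR : R = a * P + c) (hc : 0 < c)
    (hbP : (b + 1) * c < P) (h0 : w 0 = 1) (hz : z ≤ P) (ha : w (a + 1) = 0) :
    IsPrefix (1 :: List.replicate (a + 1) 0 ++ wordPow (1 :: List.replicate a 0) b) w ∧ z ≤ c ∧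
      InfReads P R (z + P - (b + 1) * c) (shift (a + 2 + b * (a + 1)) w) ∧
      w (a + 2 + b * (a + 1)) = 1 := by
  have hb : (0 : ℤ) ≤ b * c := by positivity
  have hz0 := h.letter_zero.2 h0
  obtain ⟨h1, h2, h3, h4⟩ := h.long_block hR (by linarith) hc (by linarith) h0 hz ha
  obtain ⟨h5, h6, h7⟩ := h3.short_blocks (n := b) hR (by linarith) hc
    (by simpa [shift_apply] using h4) (by linarith) (by linarith)
  refine ⟨?_, h2, ?_, by simpa [shift_apply] using h7⟩
  · rw [isPrefix_append]
    exact ⟨h1, by simpa using h5⟩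
  · rw [shift_shift] at h6
    convert h6 using 1
    ring

/-- The only minimal square root whose square can be a prefix of `w`. -/
def pick (a b : ℕ) (w : InfWord) : Word :=
  if w 0 = 0 then
    if w 1 = 0 then [0]
    else if w (a + 2) = 1 then 0 :: 1 :: List.replicate (a - 1) 0
    else 0 :: 1 :: List.replicate a 0
  else if w (a + 1) = 1 then 1 :: List.replicate a 0
  else if w (a + 2 + b * (a + 1) + (a + 1)) = 0 then
    1 :: List.replicate (a + 1) 0 ++ wordPow (1 :: List.replicate a 0) b
  else root6 a b

theorem pick_mem (a b : ℕ) (w : InfWord) : pick a b w ∈ minRoots a b := by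
  unfold pick minRoots
  split_ifs <;> simp

/-- Each of the six squares fixes the letters that `pick` inspects, so two of them are never
prefixes of the same word. -/
theorem eq_pick_of_isPrefix (ha : 1 ≤ a) {X : Word} (hX : X ∈ minRoots a b)
    (h : IsPrefix (X ++ X) w) : X = pick a b w := by
  obtain ⟨a, rfl⟩ := Nat.exists_eq_add_of_le' ha
  simp only [minRoots, List.mem_cons, List.not_mem_nil, or_false] at hX
  unfold pick
  rcases hX with rfl | rfl | rfl | rfl | rfl | rfl <;>
    simp only [isPrefix_append, isPrefix_cons, isPrefix_replicate, shift_apply, shift_shift,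
      List.length_append, List.length_cons, List.length_replicate, List.length_nil,
      length_wordPow, root6] at h
  · have h0 := h.1.1
    have h1 := h.2.1
    simp_all
  · obtain ⟨⟨h0, h1, -⟩, h2, h3, -⟩ := h
    have e : a + 1 - 1 + 1 + 1 + 1 + 0 = a + 1 + 2 := by omega
    rw [e] at h3
    simp_all
  · obtain ⟨⟨h0, h1, -⟩, h2, -⟩ := h
    have e : a + 1 + 1 + 1 + 0 = a + 1 + 2 := by omega
    rw [e] at h2
    simp_all
  · obtain ⟨⟨h0, -⟩, h2, -⟩ := h
    simp_all
  · obtain ⟨⟨⟨h0, h1⟩, -⟩, ⟨-, h3⟩, -⟩ := h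
    have h1 := h1 (a + 1) (by omega)
    have h3 := h3 (a + 1) (by omega)
    have e1 : 1 + (a + 1) = a + 1 + 1 := by omega
    have e2 : a + 1 + 1 + 1 + b * (a + 1 + 1) + 1 + (a + 1) =
      a + 1 + 2 + b * (a + 1 + 1) + (a + 1 + 1) := by omega
    rw [e1] at h1
    rw [e2] at h3
    simp_all
  · obtain ⟨⟨⟨h0, h1⟩, -⟩, ⟨h2, h3⟩, -⟩ := h
    have h1 := h1 (a + 1) (by omega)
    have e1 : 1 + (a + 1) = a + 1 + 1 := by omega
    have e2 : a + 1 + 1 + 1 + (b + 1) * (a + 1 + 1) + 0 =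
      a + 1 + 2 + b * (a + 1 + 1) + (a + 1 + 1) := by ring
    rw [e1] at h1
    rw [e2] at h2
    simp_all [root6]

theorem InfReads.isPrefix_pick (h : InfReads P R z w) (hR : R = a * P + c) (ha : 1 ≤ a) (hc : 0 < c)
    (hbP : (b + 1) * c < P) (hPb : P < (b + 2) * c) (hz : z ≤ P) :
    IsPrefix (pick a b w ++ pick a b w) w := by
  have hb : (0 : ℤ) ≤ b * c := by positivity
  have hP : 0 < P := by linarith
  have hcP : c < P := by linarith
  have zero_one : w 0 = 0 → InfReads P R (z + P) (shift 1 w) ∧ z + P ≤ P := by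
    intro h0
    refine ⟨?_, by linarith [h.letter_zero.1 h0]⟩
    simpa using h.of_isPrefix (u := [0]) (isPrefix_cons.2 ⟨h0, isPrefix_nil⟩)
  unfold pick
  split_ifs with h0 h1 h2 h3 h4
  · simp [isPrefix_cons, isPrefix_nil, shift_apply, h0, h1]
  · obtain ⟨h5, h6⟩ := zero_one h0
    have h1 := (fin_two_cases _).resolve_left h1
    obtain ⟨h7, h8⟩ := h5.short_block hR hP hc (by simpa [shift_apply] using h1) h6
    obtain ⟨h9, -⟩ := h8.short_block hR hP hc
      (by simpa [shift_apply, add_comm, add_left_comm] using h2) (by linarith)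
    obtain ⟨a, rfl⟩ := Nat.exists_eq_add_of_le' ha
    have e : (0 :: 1 :: List.replicate (a + 1 - 1) 0 ++ 0 :: 1 :: List.replicate (a + 1 - 1) 0 :
        Word) = 0 :: ((1 :: List.replicate (a + 1) 0) ++ (1 :: List.replicate a 0)) := by
      simp [List.replicate_succ']
    rw [e, isPrefix_cons, isPrefix_append]
    rw [List.replicate_succ', ← List.cons_append, isPrefix_append] at h9
    exact ⟨h0, h7, by simpa using h9.1⟩
  · obtain ⟨h5, h6⟩ := zero_one h0
    have h2 : w (a + 2) = 0 := (fin_two_cases _).resolve_right h2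
    have h1 := (fin_two_cases _).resolve_left h1
    obtain ⟨h7, h8, h9, h10⟩ := h5.long_block hR hP hc hcP (by simpa [shift_apply] using h1) h6
      (by simpa [shift_apply, add_comm, add_left_comm] using h2)
    obtain ⟨h11, -⟩ := h9.short_block hR hP hc
      (by simpa [shift_apply] using h10) (by linarith)
    have e : (0 :: 1 :: List.replicate a 0 ++ 0 :: 1 :: List.replicate a 0 :
        Word) = 0 :: ((1 :: List.replicate (a + 1) 0) ++ (1 :: List.replicate a 0)) := by
      simp [List.replicate_succ']
    rw [e, isPrefix_cons, isPrefix_append]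
    exact ⟨h0, h7, by simpa using h11⟩
  · have h0 : w 0 = 1 := (fin_two_cases _).resolve_left h0
    obtain ⟨h5, h6⟩ := h.short_block hR hP hc h0 hz
    obtain ⟨h7, -⟩ := h6.short_block hR hP hc (by simpa [shift_apply] using h3) (by linarith)
    rw [isPrefix_append]
    exact ⟨h5, by simpa using h7⟩
  · have h0 : w 0 = 1 := (fin_two_cases _).resolve_left h0
    have h3 : w (a + 1) = 0 := (fin_two_cases _).resolve_right h3
    obtain ⟨h5, h6, h7, h8⟩ := h.long_run hR hc hbP h0 hz h3
    obtain ⟨h9, -⟩ := h7.long_run hR hc hbP (by simpa [shift_apply] using h8) (by linarith)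
      (by simpa [shift_apply] using h4)
    rw [isPrefix_append]
    refine ⟨h5, ?_⟩
    convert h9 using 2
    simp [length_wordPow]; ring
  · have h0 : w 0 = 1 := (fin_two_cases _).resolve_left h0
    have h3 : w (a + 1) = 0 := (fin_two_cases _).resolve_right h3
    have h4 : w (a + 2 + b * (a + 1) + (a + 1)) = 1 := (fin_two_cases _).resolve_left h4
    obtain ⟨h5, h6, h7, h8⟩ := h.long_run hR hc hbP h0 hz h3
    obtain ⟨h9, h10⟩ := h7.short_block hR hP hc (by simpa [shift_apply] using h8) (by linarith)
    rw [shift_shift] at h10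
    -- A `1` here would need `z + P - (b+3)c ≥ 0`, against `z ≤ c` and `P < (b+2)c`. So the next
    -- block is long and the period of `S₆ ^ 2` begins again.
    have h11 : w (a + 2 + b * (a + 1) + (a + 1) + (a + 1)) = 0 := by
      refine (fin_two_cases _).resolve_right fun h12 => ?_
      obtain ⟨-, h13⟩ := h10.short_block hR hP hc (by simpa [shift_apply] using h4) (by linarith)
      have := h13.letter_zero.2 (by simpa [shift_apply] using h12)
      linarith
    obtain ⟨h12, h13, h14, h15⟩ := h10.long_run hR hc hbP (by simpa [shift_apply] using h4)
      (by linarith) (by simpa [shift_apply] using h11)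
    obtain ⟨h16, -⟩ := h14.short_block hR hP hc (by simpa [shift_apply] using h15) (by linarith)
    have e : root6 a b = (1 :: List.replicate (a + 1) 0 ++ wordPow (1 :: List.replicate a 0) b) ++
        (1 :: List.replicate a 0) := by
      rw [root6, wordPow_succ', List.append_assoc]
    have e' : (1 :: List.replicate (a + 1) 0 ++ wordPow (1 :: List.replicate a 0) b :
        Word).length = a + 2 + b * (a + 1) := by
      simp [length_wordPow]; ring
    rw [e]
    generalize (1 :: List.replicate (a + 1) 0 ++ wordPow (1 :: List.replicate a 0) b :
      Word) = u at *
    simp only [isPrefix_append (u := u ++ _), isPrefix_append (u := u), List.length_append,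
      List.length_cons, List.length_replicate, e', shift_shift] at *
    exact ⟨⟨h5, h9⟩, h12, h16⟩

end

/-! ### Square roots of readable words -/

section
variable {P R c z : ℤ} {w r : InfWord} {a b : ℕ}

theorem disp_partialProd_sq (X : ℕ → Word) (k : ℕ) :
    disp P R (partialProd (fun n => X n ++ X n) k) = 2 * disp P R (partialProd X k) := by
  induction k with
  | zero => simp
  | succ k ih => simp only [partialProd_succ, disp_append, ih]; ring

theorem InfReads.exists_isSqrt (h : InfReads P R z w) (hR : R = a * P + c) (ha : 1 ≤ a)
    (hc : 0 < c) (hbP : (b + 1) * c < P) (hPb : P < (b + 2) * c) (hz : -R ≤ z) (hz' : z ≤ P) :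
    ∃ r, IsSqrt a b w r := by
  have hb : (0 : ℤ) ≤ b * c := by positivity
  have hP : 0 ≤ P := by linarith
  have hpick : ∀ n, IsPrefix (pick a b (shift n w) ++ pick a b (shift n w)) (shift n w) := by
    intro n
    refine (h.suffix n).isPrefix_pick hR ha hc hbP hPb ?_
    exact ((h n).mem_range hz hz' hP (by rw [hR]; positivity)).2
  -- Greedy factorization: the `k`-th square starts at `pos k`.
  let pos : ℕ → ℕ := fun k => k.rec 0 fun _ n => n + 2 * (pick a b (shift n w)).length
  have hpos : ∀ k, pos (k + 1) = pos k + 2 * (pick a b (shift (pos k) w)).length := fun k => rfl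
  let X : ℕ → Word := fun k => pick a b (shift (pos k) w)
  have hX : ∀ n, X n ≠ [] := fun n => ne_nil_of_mem_minRoots (pick_mem a b _)
  have hlen : ∀ k, (partialProd (fun n => X n ++ X n) k).length = pos k := by
    intro k
    induction k with
    | zero => simp [pos]
    | succ k ih => rw [partialProd_succ, List.length_append, ih, hpos, List.length_append]; ring
  obtain ⟨r, hr⟩ := exists_isInfProd hX
  refine ⟨r, X, fun n => pick_mem a b _, isInfProd_of_isPrefix_shift (by simpa using hX) ?_, hr⟩
  intro k
  rw [hlen]
  exact hpick _

theorem IsSqrt.unique (ha : 1 ≤ a) {r' : InfWord} (h : IsSqrt a b w r) (h' : IsSqrt a b w r') :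
    r = r' := by
  obtain ⟨X, hX, hXw, hXr⟩ := h
  obtain ⟨Y, hY, hYw, hYr⟩ := h'
  have : ∀ k, X k = Y k := by
    intro k
    induction k using Nat.strong_induction_on with
    | _ k ih =>
      have hl : partialProd (fun n => X n ++ X n) k = partialProd (fun n => Y n ++ Y n) k := by
        unfold partialProd
        congr 1
        refine List.map_congr_left fun j hj => ?_
        rw [ih j (by simpa using hj)]
      rw [eq_pick_of_isPrefix ha (hX k) (hXw.isPrefix_shift k),
        eq_pick_of_isPrefix ha (hY k) (hYw.isPrefix_shift k), hl]
  rw [funext this] at hXr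
  exact hXr.unique hYr

theorem IsSqrt.infReads (h : IsSqrt a b w r) (hw : InfReads P R z w) (ha : 1 ≤ a) (hP : 0 < P)
    (h1 : a * P ≤ R) (h2 : R ≤ (a + 1) * P) : InfReads (2 * P) (2 * R) z r := by
  obtain ⟨X, hX, hXw, hXr⟩ := h
  intro n
  have h3 : Reads (2 * P) (2 * R) z (partialProd X n) := by
    refine Reads.half_flatten (fun x hx => ?_) (hw.reads ?_)
    · obtain ⟨k, -, rfl⟩ := List.mem_map.1 hx
      exact tol_of_mem_minRoots hP h1 h2 ha (hX k)
    · rw [List.map_map]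
      exact hXw.isPrefix n
  have h4 := hXr.isPrefix n
  have h5 := le_length_partialProd hXr.1 n
  refine h3.of_prefix ?_
  rw [← show factor r 0 _ = partialProd X n from h4]
  obtain ⟨m, hm⟩ := Nat.exists_eq_add_of_le h5
  rw [hm, factor_add]
  exact List.prefix_append _ _

/-- If the square root `r` of `w` is read from `z / 2` and passes through `0`, then it does so at the
beginning of a minimal square root. -/
theorem IsSqrt.letter_of_disp_eq_zero (h : IsSqrt a b w r) (hw : InfReads P R z w) (ha : 1 ≤ a)
    (hP : 0 < P) (h1 : a * P ≤ R) (h2 : R ≤ (a + 1) * P) (hco : IsCoprime (P + R) P)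
    (hq : ((root6 a b).length : ℤ) < P + R) {l : ℕ}
    (hl : z + disp (2 * P) (2 * R) (factor r 0 l) = 0) : r l = w (2 * l) := by
  obtain ⟨X, hX, hXw, hXr⟩ := h
  obtain ⟨k, j, hj, rfl⟩ := exists_position hXr.1 l
  have hr := hXr.isPrefix_shift k
  have hw2 := hXw.isPrefix_shift k
  have hwR := (hw.of_isPrefix (hXw.isPrefix k)).reads hw2
  rw [length_partialProd_sq] at hw2
  rw [disp_partialProd_sq, reads_append] at hwR
  have e : factor r 0 ((partialProd X k).length + j) = partialProd X k ++ (X k).take j := by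
    rw [factor_add, hXr.isPrefix k, zero_add]
    congr 1
    refine List.ext_getElem (by simp; omega) fun i h1 h2 => ?_
    have := isPrefix_iff.1 hr i (by simp at h2; omega)
    simpa [shift_apply] using this
  rw [e, disp_append, disp_double, disp_double] at hl
  have hrj := isPrefix_iff.1 hr j hj
  have hT := tol_iff.1 (tol_of_mem_minRoots hP h1 h2 ha (hX k)) j hj
  have hA := reads_iff.1 hwR.1 j hj
  have hB := reads_iff.1 hwR.2 j hj
  have hlen := length_le_of_mem_minRoots ha (hX k)
  have hjq : (j : ℤ) < P + R := by omega
  have key : ∀ m : ℕ, (m : ℤ) < P + R → (P + R ∣ P * m) → m = 0 := by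
    intro m hm hd
    have := Int.eq_zero_of_dvd_of_nonneg_of_lt (by positivity) hm (hco.dvd_of_dvd_mul_left hd)
    exact_mod_cast this
  have m1 := disp_modEq (P := P) (R := R) ((X k).take j)
  have m2 := disp_modEq (P := P) (R := R) (X k)
  rw [List.length_take_of_le hj.le] at m1
  -- Let `e` and `d` be the displacements of the first `j` letters and of the whole root. Where the
  -- halved walk is at `0`, both readings of the root in its square bound `e` on one side and the
  -- tolerance bounds it on the other, so `e` is `0` or `d`. Modulo `P + R` the displacement
  -- determines the length, and roots are shorter than `P + R`; thus `j` is `0` or the full length,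
  -- and the latter is excluded.
  have hj0 : j = 0 := by
    have : disp P R ((X k).take j) = 0 ∨ disp P R ((X k).take j) = disp P R (X k) := by
      rcases fin_two_cases ((X k)[j]) with h0 | h0
      · have := hT.1 h0
        have := hA.1 h0
        have := hB.1 h0
        omega
      · have := hT.2 h0
        have := hA.2 h0
        have := hB.2 h0
        omega
    rcases this with h0 | h0
    · rw [h0] at m1
      exact key j hjq (Int.modEq_zero_iff_dvd.1 m1.symm)
    · rw [h0] at m1
      have := key ((X k).length - j) (by omega) (by
        rw [Nat.cast_sub hj.le, mul_sub]
        exact Int.modEq_iff_dvd.1 (m1.symm.trans m2))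
      omega
  subst hj0
  have h5 := isPrefix_iff.1 hw2 0 (by simp; omega)
  simp only [shift_apply, add_zero] at h5 hrj ⊢
  rw [h5, hrj, List.getElem_append_left hj]

/-- Read from an odd point with even steps, a word is determined by its length. -/
theorem Reads.letter_odd {u : Word} (h : Reads (2 * P) (2 * R) z u) (hz : Odd z)
    (hz1 : -(2 * R) ≤ z) (hz2 : z ≤ 2 * P) (hP : 0 ≤ P) (hR : 0 ≤ R) (i : ℕ) (hi : i < u.length) :
    u[i] = 1 ↔ (z + 2 * (P * i)) % (2 * (P + R)) < 2 * P := by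
  have h1 := (h.of_prefix (List.take_prefix i u)).mem_range hz1 hz2 (by omega) (by omega)
  have h2 := reads_iff.1 h i hi
  rw [disp_double] at h1 h2
  have m := disp_modEq (P := P) (R := R) (u.take i)
  rw [List.length_take_of_le hi.le] at m
  have m' : (z + 2 * (P * i)) % (2 * (P + R)) =
      (z + 2 * disp P R (u.take i)) % (2 * (P + R)) :=
    (Int.ModEq.add_left z (m.mul_left' (c := 2))).symm
  rw [m']
  generalize disp P R (u.take i) = d at *
  obtain ⟨t, rfl⟩ := hz
  -- The state is odd, hence nonzero: positive states are their own residues, below `2P`, and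
  -- negative ones have residue at least `2P`.
  constructor
  · intro h3
    have := h2.2 h3
    rw [Int.emod_eq_of_lt] <;> omega
  · intro h3
    by_contra h4
    have := h2.1 ((fin_two_cases _).resolve_right h4)
    rw [← Int.add_emod_right, Int.emod_eq_of_lt] at h3 <;> omega

theorem InfReads.letter_odd (h : InfReads (2 * P) (2 * R) z r) (hz : Odd z) (hz1 : -(2 * R) ≤ z)
    (hz2 : z ≤ 2 * P) (hP : 0 ≤ P) (hR : 0 ≤ R) (i : ℕ) :
    r i = 1 ↔ (z + 2 * (P * i)) % (2 * (P + R)) < 2 * P := by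
  simpa using (h (i + 1)).letter_odd hz hz1 hz2 hP hR i (by simp)

end

/-! ### Sturmian words -/

/-- Write `α = 1 / (a + 1 + f)`; the second partial quotient and irrationality give `1/(b+2) < f <
1/(b+1)`. The factors multiplying `α` are `|S₅|` and `|S₆|`. -/
theorem IsSlope.bounds {a b : ℕ} {α : ℝ} (h : IsSlope a b α) : 0 < α ∧ α < 1 ∧
    (b + 1 : ℝ) < α * ((a + 1) * (b + 1) + 1) ∧ α * ((a + 1) * (b + 2) + 1) < b + 2 := by
  obtain ⟨hirr, hh, h0, h1⟩ := h
  have hfl : (⌊α⌋ : ℝ) = 0 := by rw [← GenContFract.of_h_eq_floor]; exact hh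
  have hfr : Int.fract α = α := by rw [Int.fract, hfl, sub_zero]
  have hfr0 : Int.fract α ≠ 0 := by rw [hfr]; exact hirr.ne_zero
  have hα0 : 0 < α := by
    rw [← hfr]; exact lt_of_le_of_ne (Int.fract_nonneg _) hfr0.symm
  have hα1 : α < 1 := by rw [← hfr]; exact Int.fract_lt_one _
  have hirr1 : Irrational α⁻¹ := irrational_inv_iff.2 hirr
  have hirr2 : Irrational (Int.fract α⁻¹) := by
    rw [Int.fract]; exact hirr1.sub_intCast _
  have hirr3 : Irrational (Int.fract α⁻¹)⁻¹ := irrational_inv_iff.2 hirr2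
  simp only [GenContFract.partDens, Stream'.Seq.map_get?] at h0 h1
  have hs0 : (GenContFract.of α).s.get? 0 = some ⟨1, ⌊(Int.fract α)⁻¹⌋⟩ :=
    GenContFract.of_s_head hfr0
  have hs1 : (GenContFract.of (Int.fract α)⁻¹).s.get? 0 = some ⟨1, ⌊(Int.fract α⁻¹)⁻¹⌋⟩ := by
    rw [hfr]
    exact GenContFract.of_s_head hirr2.ne_zero
  rw [hs0, hfr] at h0
  rw [show (1 : ℕ) = 0 + 1 from rfl, GenContFract.of_s_succ, hs1] at h1
  simp only [Option.map_some, Option.some.injEq] at h0 h1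
  have hf := Int.floor_add_fract α⁻¹
  have hf1 : 0 < Int.fract α⁻¹ := lt_of_le_of_ne (Int.fract_nonneg _) hirr2.ne_zero.symm
  rw [h0] at hf
  have hg1 := Int.floor_le (Int.fract α⁻¹)⁻¹
  have hg2 := Int.lt_floor_add_one (Int.fract α⁻¹)⁻¹
  rw [h1] at hg1 hg2
  generalize Int.fract α⁻¹ = f at *
  have hg3 : (b : ℝ) + 1 ≠ f⁻¹ := by
    intro h
    exact hirr3.ne_nat (b + 1) (by push_cast; exact h.symm)
  have hg1 := lt_of_le_of_ne hg1 hg3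
  have e1 : α * (a + 1 + f) = 1 := by rw [hf]; exact mul_inv_cancel₀ hα0.ne'
  have e2 : f * f⁻¹ = 1 := mul_inv_cancel₀ hf1.ne'
  have e3 : f * (b + 1) < 1 := by
    have : f * (b + 1) < f * f⁻¹ := mul_lt_mul_of_pos_left hg1 hf1
    rwa [e2] at this
  have e4 : 1 < f * (b + 2) := by
    have : f * f⁻¹ < f * (b + 2) := mul_lt_mul_of_pos_left (by linarith) hf1
    rwa [e2] at this
  refine ⟨hα0, hα1, ?_, ?_⟩
  · have := mul_pos hα0 (sub_pos.2 e3)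
    have e5 : (b + 1) * (α * (a + 1 + f)) = (b + 1 : ℝ) := by rw [e1, mul_one]
    nlinarith
  · have := mul_pos hα0 (sub_pos.2 e4)
    have e5 : (b + 2) * (α * (a + 1 + f)) = (b + 2 : ℝ) := by rw [e1, mul_one]
    nlinarith

theorem fract_add_of_lt {y α : ℝ} (h0 : 0 < α) (h : Int.fract y < 1 - α) :
    Int.fract (y + α) = Int.fract y + α := by
  refine Int.fract_eq_iff.2 ⟨by linarith [Int.fract_nonneg y], by linarith, ⌊y⌋, ?_⟩
  linarith [Int.floor_add_fract y]

theorem fract_add_of_le {y α : ℝ} (h1 : α < 1) (h : 1 - α ≤ Int.fract y) :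
    Int.fract (y + α) = Int.fract y + α - 1 := by
  refine Int.fract_eq_iff.2 ⟨by linarith, by linarith [Int.fract_lt_one y], ⌊y⌋ + 1, ?_⟩
  push_cast
  linarith [Int.floor_add_fract y]

/-- The circle is cut so that the border between the two letters lies at `0`. With closed
inequalities on both sides the two coding conventions need no further distinction. -/
theorem IsSturmian.exists_orbit {α : ℝ} {s : InfWord} (h : IsSturmian α s) (h0 : 0 < α)
    (h1 : α < 1) : ∃ d : ℕ → ℝ, (∀ n, d (n + 1) = d n + α - (s n : ℕ)) ∧
      (∀ n, -(1 - α) ≤ d n ∧ d n ≤ α) ∧ ∀ n, (s n = 0 → d n ≤ 0) ∧ (s n = 1 → 0 ≤ d n) := by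
  obtain ⟨x, hx | hx⟩ := h
  · refine ⟨fun n => Int.fract (x + n * α) - (1 - α), fun n => ?_, fun n => ?_, fun n => ?_⟩
    · have e : x + ((n + 1 : ℕ) : ℝ) * α = (x + n * α) + α := by push_cast; ring
      have hn := hx n
      dsimp only
      rw [e]
      rcases fin_two_cases (s n) with h2 | h2
      · rw [fract_add_of_lt h0 (not_le.1 (by rw [← hn, h2]; simp)), h2]; simp; ring
      · rw [fract_add_of_le h1 (hn.1 h2), h2]; simp; ring
    · have := Int.fract_nonneg (x + n * α)
      have := Int.fract_lt_one (x + n * α)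
      constructor <;> linarith
    · constructor
      · intro h2
        have : ¬ (1 - α ≤ Int.fract (x + n * α)) := by rw [← hx, h2]; simp
        linarith
      · intro h2
        linarith [(hx n).1 h2]
  · refine ⟨fun n => 1 - Int.fract (-(x + n * α)) - (1 - α), fun n => ?_, fun n => ?_, fun n => ?_⟩
    · have e : -(x + n * α) = -(x + ((n + 1 : ℕ) : ℝ) * α) + α := by push_cast; ring
      have hn := hx n
      dsimp only
      rw [e] at hn ⊢
      generalize -(x + ((n + 1 : ℕ) : ℝ) * α) = y at *
      -- Here the orbit is followed through its negative: `y` belongs to time `n + 1` and `y + α` to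
      -- time `n`, so a step forward is a rotation by `1 - α`.
      have e2 : y = y + α + (1 - α) - (1 : ℤ) := by push_cast; ring
      have e3 : Int.fract y = Int.fract (y + α + (1 - α)) := by
        conv_lhs => rw [e2, Int.fract_sub_intCast]
      rcases fin_two_cases (s n) with h2 | h2
      · have : ¬ (1 - α < 1 - Int.fract (y + α)) := by rw [← hn, h2]; simp
        rw [e3, fract_add_of_le (α := 1 - α) (by linarith) (by linarith), h2]; simp; ring
      · have := hn.1 h2
        rw [e3, fract_add_of_lt (α := 1 - α) (by linarith) (by linarith), h2]; simp; ring
    · have := Int.fract_nonneg (-(x + n * α))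
      have := Int.fract_lt_one (-(x + n * α))
      constructor <;> linarith
    · constructor
      · intro h2
        have : ¬ (1 - α < 1 - Int.fract (-(x + n * α))) := by rw [← hx, h2]; simp
        linarith
      · intro h2
        linarith [(hx n).1 h2]

/-- The `n`-th letter of the periodic word `S ^ ω`. -/
def cyc (S : Word) (n : ℕ) : Fin 2 := S.getD (n % S.length) 0

theorem cyc_of_lt {S : Word} {n : ℕ} (h : n < S.length) : cyc S n = S[n] := by
  rw [cyc, Nat.mod_eq_of_lt h, List.getD_eq_getElem _ _ h]

theorem cyc_add_length (S : Word) (n : ℕ) : cyc S (n + S.length) = cyc S n := by simp [cyc]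

theorem exists_orbit_cyc {α : ℝ} {s : InfWord} {S : Word} (h : IsSturmian α s) (h0 : 0 < α)
    (h1 : α < 1) (hS : S ++ S ∈ language s) : ∃ d : ℕ → ℝ,
      (∀ n < 2 * S.length, d (n + 1) = d n + α - (cyc S n : ℕ)) ∧
      (∀ n, -(1 - α) ≤ d n ∧ d n ≤ α) ∧
      ∀ n < 2 * S.length, (cyc S n = 0 → d n ≤ 0) ∧ (cyc S n = 1 → 0 ≤ d n) := by
  obtain ⟨d, hd1, hd2, hd3⟩ := h.exists_orbit h0 h1
  obtain ⟨i, hi⟩ := hS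
  have key : ∀ n < 2 * S.length, s (i + n) = cyc S n := by
    intro n hn
    rw [cyc, ← getD_wordPow S 2 n hn]
    have e : wordPow S 2 = factor s i (S ++ S).length := by
      rw [hi, wordPow_succ, wordPow_succ, wordPow_zero, List.append_nil]
    rw [e, List.getD_eq_getElem _ _ (by simp; omega), getElem_factor]
  refine ⟨fun n => d (i + n), fun n hn => ?_, fun n => hd2 _, fun n hn => ?_⟩
  · rw [← key n hn]
    exact hd1 (i + n)
  · rw [← key n hn]
    exact hd3 (i + n)

/-- The letters of `S ^ ω` as integers. -/
def cycInt (S : Word) (n : ℕ) : ℤ := (cyc S n : ℕ)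

theorem cycInt_add_length (S : Word) (n : ℕ) : cycInt S (n + S.length) = cycInt S n := by
  rw [cycInt, cyc_add_length, cycInt]

theorem sum_cycInt {S : Word} {n : ℕ} (h : n ≤ S.length) :
    ∑ j ∈ Finset.range n, cycInt S j = (S.take n).count 1 := by
  induction n with
  | zero => simp
  | succ n ih =>
    rw [Finset.sum_range_succ, ih (by omega), List.take_succ_eq_append_getElem (by omega),
      List.count_append, cycInt, cyc_of_lt (by omega)]
    rcases fin_two_cases (S[n]) with h0 | h0 <;> simp [h0]

theorem sum_shift_of_periodic {f : ℕ → ℤ} {q : ℕ} (hf : ∀ n, f (n + q) = f n) (j : ℕ) :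
    ∑ i ∈ Finset.range q, f (i + j) = ∑ i ∈ Finset.range q, f i := by
  induction j with
  | zero => simp
  | succ j ih =>
    rw [← ih]
    have h1 := Finset.sum_range_succ (fun i => f (i + j)) q
    have h2 := Finset.sum_range_succ' (fun i => f (i + j)) q
    have h3 : f (q + j) = f (0 + j) := by rw [add_comm q, hf, zero_add]
    have h4 : ∀ i, f (i + 1 + j) = f (i + (j + 1)) := fun i => by congr 1; ring
    simp only [h4] at h2
    linarith

theorem mul_sum_eq_sum_window {f : ℕ → ℤ} {q : ℕ} (hf : ∀ n, f (n + q) = f n) (Q : ℕ) :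
    ∑ i ∈ Finset.range q, ∑ j ∈ Finset.range Q, f (i + j) = Q * ∑ i ∈ Finset.range q, f i := by
  rw [Finset.sum_comm, Finset.sum_congr rfl fun j _ => sum_shift_of_periodic hf j]
  simp

theorem orbit_add {α : ℝ} {S : Word} {d : ℕ → ℝ}
    (hd : ∀ n < 2 * S.length, d (n + 1) = d n + α - (cyc S n : ℕ)) (i Q : ℕ)
    (h : i + Q ≤ 2 * S.length) :
    d (i + Q) = d i + Q * α - (∑ j ∈ Finset.range Q, cycInt S (i + j) : ℤ) := by
  induction Q with
  | zero => simp
  | succ Q ih =>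
    rw [← add_assoc, hd _ (by omega), ih (by omega), Finset.sum_range_succ, cycInt]
    push_cast; ring

/-! ### From a Sturmian square to a rational rotation -/

section
variable {α : ℝ} {S : Word} {d : ℕ → ℝ}

/-- The orbit lies in an interval of length `1`, so a window of length `Q` has fewer than `p + 1`
ones. Summing over all `|S|` cyclic windows counts each one of `S` exactly `Q` times. -/
theorem count_le_of_slope_lt {Q : ℕ} {p : ℤ}
    (hd : ∀ n < 2 * S.length, d (n + 1) = d n + α - (cyc S n : ℕ))
    (hd2 : ∀ n, -(1 - α) ≤ d n ∧ d n ≤ α) (hQ : Q ≤ S.length) (h : α * Q < p) :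
    (Q : ℤ) * S.count 1 ≤ S.length * p := by
  have h1 := mul_sum_eq_sum_window (cycInt_add_length S) Q
  rw [sum_cycInt le_rfl, List.take_length] at h1
  rw [← h1]
  have : ∀ i ∈ Finset.range S.length, ∑ j ∈ Finset.range Q, cycInt S (i + j) ≤ p := by
    intro i hi
    have hi := Finset.mem_range.1 hi
    have h2 := orbit_add hd i Q (by omega)
    have h3 := hd2 i
    have h4 := hd2 (i + Q)
    rw [← Int.lt_add_one_iff, ← Int.cast_lt (R := ℝ)]
    push_cast at h2 ⊢
    linarith
  simpa using Finset.sum_le_sum this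

theorem le_count_of_lt_slope {Q : ℕ} {p : ℤ}
    (hd : ∀ n < 2 * S.length, d (n + 1) = d n + α - (cyc S n : ℕ))
    (hd2 : ∀ n, -(1 - α) ≤ d n ∧ d n ≤ α) (hQ : Q ≤ S.length) (h : p < α * Q) :
    (S.length : ℤ) * p ≤ Q * S.count 1 := by
  have h1 := mul_sum_eq_sum_window (cycInt_add_length S) Q
  rw [sum_cycInt le_rfl, List.take_length] at h1
  rw [← h1]
  have : ∀ i ∈ Finset.range S.length, p ≤ ∑ j ∈ Finset.range Q, cycInt S (i + j) := by
    intro i hi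
    have hi := Finset.mem_range.1 hi
    have h2 := orbit_add hd i Q (by omega)
    have h3 := hd2 i
    have h4 := hd2 (i + Q)
    rw [← Int.sub_one_lt_iff, ← Int.cast_lt (R := ℝ)]
    push_cast at h2 ⊢
    linarith
  simpa using Finset.sum_le_sum this

/-- A word whose square is Sturmian is read along a rational rotation. -/
theorem exists_reads_of_orbit (hα : Irrational α)
    (hd : ∀ n < 2 * S.length, d (n + 1) = d n + α - (cyc S n : ℕ))
    (hs : ∀ n < 2 * S.length, (cyc S n = 0 → d n ≤ 0) ∧ (cyc S n = 1 → 0 ≤ d n)) (hq : S ≠ []) :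
    ∃ y : ℤ, Odd y ∧
      Reads (2 * (S.count 1 : ℤ)) (2 * (S.length - S.count 1 : ℤ)) y S := by
  set p : ℤ := ((S.count 1 : ℕ) : ℤ) with hp
  set q := S.length with hq'
  have hq0 : 0 < q := List.length_pos_of_ne_nil hq
  set δ : ℝ := q * α - p with hδ
  have hδ0 : δ ≠ 0 := by
    intro h
    have : Irrational ((q : ℝ) * α) := hα.natCast_mul hq0.ne'
    exact this.ne_int p (by linarith)
  -- With this start the walk stands, before letter `i`, at `(i + 1/2) d_i + (q - i - 1/2) d_(i+q)`:
  -- a positive combination of the two orbit points at which `S²` reads `S[i]`, hence of the right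
  -- sign. For the letter `0` it is strictly negative because `d_(i+q) - d_i = δ ≠ 0`, so `Y` may be
  -- replaced by the half-integer `⌊Y⌋ + 1/2`.
  set Y : ℝ := q * d 0 + (q - 1 / 2) * δ with hY
  refine ⟨2 * ⌊Y⌋ + 1, odd_two_mul_add_one _, reads_iff.2 fun i hi => ?_⟩
  have h1 := orbit_add hd 0 i (by omega)
  have h2 := orbit_add hd i q (by omega)
  have h3 := sum_shift_of_periodic (cycInt_add_length S) i
  simp only [zero_add] at h1
  rw [sum_cycInt hi.le] at h1
  simp only [add_comm _ i] at h3
  rw [h3, sum_cycInt le_rfl, List.take_length] at h2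
  rw [disp_double, disp_eq, List.length_take_of_le hi.le]
  have h4 := hs i (by omega)
  have h5 := hs (i + q) (by omega)
  rw [cyc_add_length] at h5
  rw [cyc_of_lt hi] at h4 h5
  set m : ℤ := (((S.take i).count 1 : ℕ) : ℤ)
  have hk : (p * i - (p + (q - p)) * m : ℤ) = p * i - q * m := by ring
  rw [hk]
  have hE : Y + (p * i - q * m : ℤ) = (i + 1 / 2) * d i + (q - i - 1 / 2) * (d i + δ) := by
    rw [h1, hY, hδ]; push_cast; ring
  have hdi : d (i + q) = d i + δ := by rw [h2, hδ]; ring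
  rw [hdi] at h5
  have hi1 : (0 : ℝ) < i + 1 / 2 := by positivity
  have hi2 : (0 : ℝ) < q - i - 1 / 2 := by
    have : (i : ℝ) + 1 ≤ q := by exact_mod_cast hi
    linarith
  have hfl : ⌊Y + (p * i - q * m : ℤ)⌋ = ⌊Y⌋ + (p * i - q * m) := Int.floor_add_intCast _ _
  constructor
  · intro h0
    have h4 := h4.1 h0
    have h5 := h5.1 h0
    have : Y + (p * i - q * m : ℤ) < (0 : ℤ) := by
      rw [hE, Int.cast_zero]
      rcases lt_or_gt_of_ne hδ0 with h | h
      · nlinarith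
      · nlinarith
    have := Int.floor_lt.2 this
    omega
  · intro h0
    have h4 := h4.2 h0
    have h5 := h5.2 h0
    have : ((0 : ℤ) : ℝ) ≤ Y + (p * i - q * m : ℤ) := by
      rw [hE, Int.cast_zero]
      positivity
    have := Int.le_floor.2 this
    omega

end

/-! ### Seeds -/

section
variable {P R z : ℤ}

theorem Reads.add_disp_le_max {u : Word} (h : Reads P R z u) (hR : 0 ≤ R) :
    z + disp P R u ≤ max P z := by
  induction u generalizing z with
  | nil => simp
  | cons x u ih =>
    obtain ⟨h1, -, h3⟩ := h
    have := ih h3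
    rcases fin_two_cases x with rfl | rfl
    · have := h1 rfl
      simp at *; omega
    · simp at *; omega

theorem Reads.min_le_add_disp {u : Word} (h : Reads P R z u) (hP : 0 ≤ P) :
    min (-R) z ≤ z + disp P R u := by
  induction u generalizing z with
  | nil => simp
  | cons x u ih =>
    obtain ⟨-, h2, h3⟩ := h
    have := ih h3
    rcases fin_two_cases x with rfl | rfl
    · simp at *; omega
    · have := h2 rfl
      simp at *; omega

/-- A point from which a closed path starts is in the range of the interval exchange. -/
theorem Reads.mem_range_of_disp_eq_zero {u : Word} (h : Reads P R z u) (hP : 0 < P) (hR : 0 < R)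
    (hu : u ≠ []) (hd : disp P R u = 0) : -R ≤ z ∧ z ≤ P := by
  obtain ⟨x, u, rfl⟩ := List.exists_cons_of_ne_nil hu
  obtain ⟨h1, h2, h3⟩ := h
  have h4 := Reads.add_disp_le_max h3 hR.le
  have h5 := Reads.min_le_add_disp h3 hP.le
  rcases fin_two_cases x with rfl | rfl
  · have := h1 rfl
    simp at *; omega
  · have := h2 rfl
    simp at *; omega

end

theorem exists_mul_modEq {P q : ℤ} (h : IsCoprime q P) (hq : 0 < q) (k : ℤ) :
    ∃ i : ℕ, (i : ℤ) < q ∧ P * i ≡ k [ZMOD q] := by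
  obtain ⟨u, v, huv⟩ := h
  refine ⟨((v * k) % q).toNat, ?_, ?_⟩
  · rw [Int.toNat_of_nonneg (Int.emod_nonneg _ hq.ne')]
    exact Int.emod_lt_of_pos _ hq
  · rw [Int.toNat_of_nonneg (Int.emod_nonneg _ hq.ne')]
    have h1 : P * ((v * k) % q) ≡ P * (v * k) [ZMOD q] := (Int.mod_modEq _ _).mul_left P
    refine h1.trans (Int.modEq_iff_dvd.2 ⟨u * k, ?_⟩)
    linear_combination (-k) * huv

theorem eq_wordPow_of_getD {S : Word} {m g : ℕ} (hm : m * g = S.length)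
    (h : ∀ i < S.length, S.getD i 0 = S.getD (i % m) 0) : S = wordPow (S.take m) g := by
  rcases Nat.eq_zero_or_pos g with rfl | hg
  · simp at hm
    rw [wordPow_zero, List.length_eq_zero_iff.1 hm.symm]
  have hml : m ≤ S.length := hm ▸ Nat.le_mul_of_pos_right _ hg
  have hl : (S.take m).length = m := List.length_take_of_le hml
  have hl2 : (wordPow (S.take m) g).length = S.length := by rw [length_wordPow, hl, mul_comm, hm]
  refine List.ext_getElem hl2.symm fun i h1 h2 => ?_
  rw [← List.getD_eq_getElem _ 0 h1, ← List.getD_eq_getElem _ 0 h2, getD_wordPow _ _ _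
    (by rw [hl, mul_comm, hm]; exact h1), hl, h i h1]
  have hm0 : 0 < m := Nat.pos_of_ne_zero (by rintro rfl; omega)
  have := Nat.mod_lt i hm0
  rw [List.getD_eq_getElem _ _ (by omega), List.getD_eq_getElem _ _ (by omega)]
  simp

/-- The combinatorial data of a seed: it is read along the rotation by `P / (P + R)` from one of
the two points next to the singularity. -/
structure SeedData (a b : ℕ) (S : Word) (P R c σ : ℤ) : Prop where
  one_le : 1 ≤ a
  primitive : Primitive S
  R_eq : R = a * P + c
  c_pos : 0 < c
  lt_P : (b + 1) * c < P
  P_lt : P < (b + 2) * c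
  length_eq : (S.length : ℤ) = P + R
  root_lt : (root6 a b).length < S.length
  coprime : IsCoprime (P + R) P
  disp_eq_zero : disp P R S = 0
  sign : σ = 1 ∨ σ = -1
  reads : Reads (2 * P) (2 * R) σ S

/-- From an odd start the `i`-th letter depends only on `P * i` modulo `P + R`. With `g` the gcd,
`S` has period `|S| / g` and is a `g`-th power. -/
theorem isCoprime_of_primitive {S : Word} {P R y : ℤ} (hS : Primitive S) (hP : 0 < P) (hR : 0 < R)
    (hlen : (S.length : ℤ) = P + R) (hy : Odd y) (hy1 : -(2 * R) ≤ y) (hy2 : y ≤ 2 * P)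
    (h : Reads (2 * P) (2 * R) y S) : IsCoprime (P + R) P := by
  rw [Int.isCoprime_iff_gcd_eq_one, ← hlen]
  set g := Int.gcd S.length P with hg
  obtain ⟨m, hm⟩ : g ∣ S.length := by
    have := Int.gcd_dvd_left (S.length : ℤ) P
    exact_mod_cast this
  obtain ⟨P', hP'⟩ : (g : ℤ) ∣ P := Int.gcd_dvd_right _ _
  refine hS (S.take m) g (eq_wordPow_of_getD (by rw [hm, mul_comm]) fun i hi => ?_)
  have hi' : i % m < S.length := (Nat.mod_le _ _).trans_lt hi
  rw [List.getD_eq_getElem _ _ hi, List.getD_eq_getElem _ _ hi']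
  have h1 := h.letter_odd hy hy1 hy2 hP.le hR.le i hi
  have h2 := h.letter_odd hy hy1 hy2 hP.le hR.le _ hi'
  have e : y + 2 * (P * i) ≡ y + 2 * (P * (i % m : ℕ)) [ZMOD 2 * (P + R)] := by
    refine Int.ModEq.add_left _ (Int.ModEq.mul_left'
      (Int.modEq_iff_dvd.2 ⟨-(P' * (i / m : ℕ)), ?_⟩))
    have e1 : (i : ℤ) = (i % m : ℕ) + m * (i / m : ℕ) := by
      exact_mod_cast (Nat.mod_add_div i m).symm
    rw [← hlen]
    conv_lhs => rw [e1]
    rw [hm]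
    conv_lhs => rw [hP']
    push_cast
    ring
  rw [e, ← h2] at h1
  rcases fin_two_cases (S[i]) with h3 | h3
  · rcases fin_two_cases (S[i % m]) with h4 | h4
    · rw [h3, h4]
    · rw [h1.2 h4, h4]
  · rw [h3, h1.1 h3]

theorem exists_reads_of_sturmian {a b : ℕ} {S : Word} (hprim : Primitive S)
    (hlen : (root6 a b).length < S.length) {α : ℝ} {s : InfWord} (hα : IsSlope a b α)
    (hs : IsSturmian α s) (hlang : S ++ S ∈ language s) :
    ∃ P R c y : ℤ, R = a * P + c ∧ 0 < c ∧ (b + 1) * c < P ∧ P < (b + 2) * c ∧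
      (S.length : ℤ) = P + R ∧ IsCoprime (P + R) P ∧ disp P R S = 0 ∧ Odd y ∧
      -(2 * R) ≤ y ∧ y ≤ 2 * P ∧ Reads (2 * P) (2 * R) y S := by
  have hne : S ≠ [] := by rintro rfl; simp at hlen
  obtain ⟨hα0, hα1, hlow, hup⟩ := hα.bounds
  obtain ⟨d, hd1, hd2, hd3⟩ := exists_orbit_cyc hs hα0 hα1 hlang
  have hl6 := length_root6 a b
  rw [hl6] at hlen
  have hW1 := count_le_of_slope_lt (Q := (a + 1) * (b + 2) + 1) (p := b + 2) hd1 hd2 hlen.le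
    (by push_cast; exact hup)
  have hlen1 : (a + 1) * (b + 1) + 1 < S.length := lt_of_le_of_lt (by nlinarith) hlen
  have hW2 := le_count_of_lt_slope (Q := (a + 1) * (b + 1) + 1) (p := b + 1) hd1 hd2 hlen1.le
    (by push_cast; exact hlow)
  obtain ⟨y, hy, hyS⟩ := exists_reads_of_orbit hα.1 hd1 hd3 hne
  have hcount : S.count 1 ≤ S.length := List.count_le_length
  set P : ℤ := ((S.count 1 : ℕ) : ℤ) with hPdef
  set q : ℤ := (S.length : ℤ) with hq
  set R : ℤ := q - P with hRdef
  push_cast at hW1 hW2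
  have hq0 : 0 < q := by omega
  have hab : (0 : ℤ) ≤ a * b := by positivity
  have hP : 0 < P := by
    by_contra hP
    nlinarith
  have hR : 0 < R := by
    by_contra hR
    nlinarith
  have hdisp : disp P R S = 0 := by rw [disp_eq]; ring
  have hlenq : (S.length : ℤ) = P + R := by rw [hRdef]; ring
  have hyr := hyS.mem_range_of_disp_eq_zero (by omega) (by omega) hne
    (by rw [disp_double, hdisp]; rfl)
  have hco := isCoprime_of_primitive hprim hP hR hlenq hy hyr.1 hyr.2 hyS
  have hlenZ : ((a : ℤ) + 1) * (b + 2) + 1 < q := by rw [hq]; exact_mod_cast hlen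
  -- Makes the averaged inequalities strict: equality would force `q` to divide `P` times `|S₅|` or
  -- `|S₆|`, both smaller than `q`.
  have hnd : ∀ k : ℤ, 0 < k → k < q → ¬ (q ∣ P * k) := by
    intro k hk hkq hdvd
    rw [← hlenq] at hco
    exact absurd (Int.le_of_dvd hk (hco.dvd_of_dvd_mul_left hdvd)) (by omega)
  have hS1 : (((a : ℤ) + 1) * (b + 2) + 1) * P < q * (b + 2) := by
    refine lt_of_le_of_ne hW1 fun e => hnd (((a : ℤ) + 1) * (b + 2) + 1) (by positivity) hlenZ ?_
    exact ⟨b + 2, by rw [← e]; ring⟩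
  have hS2 : q * (b + 1) < (((a : ℤ) + 1) * (b + 1) + 1) * P := by
    refine lt_of_le_of_ne hW2 fun e => hnd (((a : ℤ) + 1) * (b + 1) + 1) (by positivity)
      (by nlinarith) ?_
    exact ⟨b + 1, by rw [e]; ring⟩
  set c : ℤ := R - a * P with hc
  have hc1 : (b + 1) * c < P := by rw [hc, hRdef]; linarith
  have hc2 : P < (b + 2) * c := by rw [hc, hRdef]; linarith
  have hc0 : 0 < c := by
    by_contra h0
    nlinarith
  have hRc : R = a * P + c := by rw [hc]; ring
  exact ⟨P, R, c, y, hRc, hc0, hc1, hc2, hlenq, hco, hdisp, hy, hyr.1, hyr.2, hyS⟩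

/-- `P` is invertible modulo `P + R`, so the walk meets every odd residue class modulo `2(P + R)`,
and each class has at most one point in the allowed range. -/
theorem Reads.exists_visit {S : Word} {P R y τ : ℤ} (h : Reads (2 * P) (2 * R) y S) (hP : 0 < P)
    (hR : 0 < R) (hlen : (S.length : ℤ) = P + R) (hco : IsCoprime (P + R) P) (hy : Odd y)
    (hy1 : -(2 * R) ≤ y) (hy2 : y ≤ 2 * P) (hτ : Odd τ) (hτ1 : -(2 * R) < τ) (hτ2 : τ < 2 * P) :
    ∃ (i : ℕ) (_ : i < S.length), y + 2 * disp P R (S.take i) = τ := by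
  obtain ⟨k, hk⟩ := hτ.sub_odd hy
  obtain ⟨i, hi, hik⟩ := exists_mul_modEq hco (by omega) k
  have hi' : i < S.length := by omega
  refine ⟨i, hi', ?_⟩
  have h1 := (h.of_prefix (List.take_prefix i S)).mem_range hy1 hy2 (by omega) (by omega)
  rw [disp_double] at h1
  have h2 := disp_modEq (P := P) (R := R) (S.take i)
  rw [List.length_take_of_le hi'.le] at h2
  obtain ⟨t, ht⟩ := Int.modEq_iff_dvd.1 (h2.trans hik)
  have hdvd : 2 * (P + R) ∣ τ - (y + 2 * disp P R (S.take i)) := ⟨t, by linarith⟩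
  have := Int.eq_zero_of_abs_lt_dvd hdvd (abs_lt.2 ⟨by linarith, by linarith⟩)
  linarith

/-- A closed path along a rational rotation that reads a solution starts next to the singularity. -/
theorem eq_one_or_eq_neg_one_of_isSolution {a b : ℕ} {S : Word} {P R y : ℤ} (ha : 1 ≤ a)
    (hS : IsSolution a b S) (hP : 0 < P) (hR : 0 < R) (hR1 : a * P ≤ R) (hR2 : R ≤ (a + 1) * P)
    (hlen : (S.length : ℤ) = P + R) (hco : IsCoprime (P + R) P) (hdisp : disp P R S = 0)
    (hy : Odd y) (hy1 : -(2 * R) ≤ y) (hy2 : y ≤ 2 * P) (hyS : Reads (2 * P) (2 * R) y S) :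
    y = 1 ∨ y = -1 := by
  obtain ⟨-, X, hX, hSX, hXX⟩ := hS
  have hSS : Reads (2 * P) (2 * R) y (S ++ S) := by
    refine reads_append.2 ⟨hyS, ?_⟩
    rw [disp_double, hdisp]; simpa using hyS
  -- As a solution, `S` is the root of `S²`, so it is read from `y / 4` as well as from `y / 2`.
  have hhalf : Reads (2 * (2 * P)) (2 * (2 * R)) y S := by
    rw [hSX]
    refine Reads.half_flatten (fun x hx => ?_) (by rw [hXX, ← hSX]; exact hSS)
    exact tol_of_mem_minRoots (by omega) (by linarith) (by linarith) ha (hX x hx)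
  have hquarter : ∀ (i : ℕ) (h : i < S.length), (S[i] = 0 → y + 4 * disp P R (S.take i) ≤ 0) ∧
      (S[i] = 1 → 0 ≤ y + 4 * disp P R (S.take i)) := by
    intro i hi
    have := reads_iff.1 hhalf i hi
    rw [disp_double, disp_double] at this
    constructor
    · intro h; linarith [this.1 h]
    · intro h; linarith [this.2 h]
  obtain ⟨i, hi, hi1⟩ := hyS.exists_visit hP hR hlen hco hy hy1 hy2 odd_one (by omega) (by omega)
  obtain ⟨j, hj, hj1⟩ := hyS.exists_visit hP hR hlen hco hy hy1 hy2 (τ := -1) (by decide)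
    (by omega) (by omega)
  have h1 := reads_iff.1 hyS i hi
  have h2 := reads_iff.1 hyS j hj
  rw [disp_double] at h1 h2
  -- Where the first walk is at `1`, the second is at `2 - y` and reads a `1`; where the first is at
  -- `-1`, the second is at `-2 - y` and reads a `0`. Hence `-2 ≤ y ≤ 2`.
  have hSi : S[i] = 1 := by
    refine (fin_two_cases _).resolve_left fun h => ?_
    have := h1.1 h
    omega
  have hSj : S[j] = 0 := by
    refine (fin_two_cases _).resolve_right fun h => ?_
    have := h2.2 h
    omega
  have h3 := (hquarter i hi).2 hSi
  have h4 := (hquarter j hj).1 hSj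
  obtain ⟨k, rfl⟩ := hy
  omega

theorem IsSeed.exists_seedData {a b : ℕ} {S : Word} (ha : 1 ≤ a) (h : IsSeed a b S) :
    ∃ P R c σ : ℤ, SeedData a b S P R c σ := by
  obtain ⟨hprim, hsol, hlen, α, s, hα, hs, hlang⟩ := h
  obtain ⟨P, R, c, y, hR, hc, hcP, hPc, hl, hco, hd, hy, hy1, hy2, hyS⟩ :=
    exists_reads_of_sturmian hprim hlen hα hs hlang
  have hbc : 0 ≤ b * c := by positivity
  have hP : 0 < P := by linarith
  have haP : 0 ≤ a * P := by positivity
  exact ⟨P, R, c, y, ha, hprim, hR, hc, hcP, hPc, hl, hlen, hco, hd,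
    eq_one_or_eq_neg_one_of_isSolution ha hsol hP (by linarith) (by linarith) (by linarith) hl hco
      hd hy hy1 hy2 hyS, hyS⟩

/-! ### The words `Γ` -/

theorem swap_swap_append {u v : Word} (hu : 2 ≤ u.length) : swap (swap u ++ v) = u ++ v := by
  match u, hu with
  | x :: y :: t, _ => rfl

theorem length_swap (u : Word) : (swap u).length = u.length := by
  match u with
  | [] => rfl
  | [x] => rfl
  | x :: y :: t => rfl

theorem disp_swap (P R : ℤ) (u : Word) : disp P R (swap u) = disp P R u := by
  match u with
  | [] => rfl
  | [x] => rfl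
  | x :: y :: t => simp [swap]; ring

theorem getD_swap {u : Word} {n : ℕ} (hn : 2 ≤ n) : (swap u).getD n 0 = u.getD n 0 := by
  obtain ⟨n, rfl⟩ := Nat.exists_eq_add_of_le' hn
  match u with
  | [] => rfl
  | [x] => rfl
  | x :: y :: t => simp [swap]

theorem getD_swap_zero {u : Word} (hu : 2 ≤ u.length) : (swap u).getD 0 0 = u.getD 1 0 := by
  match u, hu with
  | x :: y :: t, _ => simp [swap]

theorem getD_swap_one {u : Word} (hu : 2 ≤ u.length) : (swap u).getD 1 0 = u.getD 0 0 := by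
  match u, hu with
  | x :: y :: t, _ => simp [swap]

theorem gammaSeq_mono {S : Word} (hS : 2 ≤ S.length) (e : ℕ) {i j : ℕ} (hij : i ≤ j) :
    gammaSeq S (2 * i + e) <+: gammaSeq S (2 * j + e) := by
  induction j, hij using Nat.le_induction with
  | base => exact List.prefix_rfl
  | succ j _ ih =>
    refine ih.trans ?_
    rw [show 2 * (j + 1) + e = 2 * j + e + 2 by ring]
    exact gammaSeq_prefix hS _

theorem length_gammaSeq (S : Word) (k : ℕ) : (gammaSeq S k).length = S.length * 3 ^ k := by
  induction k with
  | zero => simp [gammaSeq]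
  | succ k ih => simp only [gammaSeq, List.length_append, length_swap, ih]; ring

theorem IsGamma.exists_isPrefix {S : Word} {Γ : InfWord} (h : IsGamma S Γ) (hS : 2 ≤ S.length) :
    ∃ e, ∀ k, IsPrefix (gammaSeq S (2 * k + e)) Γ := by
  have : ∃ e, IsWordLimit (fun k => gammaSeq S (2 * k + e)) Γ := by
    rcases h with h | h
    · exact ⟨1, h⟩
    · exact ⟨0, h⟩
  obtain ⟨e, h⟩ := this
  refine ⟨e, fun k => ?_⟩
  obtain ⟨K, hK⟩ := h (gammaSeq S (2 * k + e)).length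
  have h1 := hK (max K k) (le_max_left _ _)
  have h2 := gammaSeq_mono hS e (le_max_right K k)
  exact (List.prefix_of_prefix_length_le h1 h2 (by simp)).eq_of_length (by simp)

theorem padicValNat_three_add {k c r : ℕ} (hr : 0 < r) (hrk : r < 3 ^ k) :
    padicValNat 3 (c * 3 ^ k + r) = padicValNat 3 r := by
  obtain ⟨v, u, hu, rfl⟩ := Nat.exists_eq_pow_mul_and_not_dvd hr.ne' 3 (by norm_num)
  have hu0 : 0 < u := Nat.pos_of_mul_pos_left hr
  have hvk : v < k := by
    have : 3 ^ v < 3 ^ k := (Nat.le_mul_of_pos_right _ hu0).trans_lt hrk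
    exact (Nat.pow_lt_pow_iff_right (by norm_num)).1 this
  have hval : ∀ u : ℕ, ¬ 3 ∣ u → padicValNat 3 (3 ^ v * u) = v := by
    intro u hu
    rw [padicValNat.mul (by positivity) (by rintro rfl; simp at hu), padicValNat.prime_pow,
      padicValNat.eq_zero_of_not_dvd hu, add_zero]
  obtain ⟨t, rfl⟩ := Nat.exists_eq_add_of_lt hvk
  rw [show c * 3 ^ (v + t + 1) + 3 ^ v * u = 3 ^ v * (3 * (c * 3 ^ t) + u) by ring, hval u hu, hval]
  rwa [Nat.dvd_add_right (dvd_mul_right _ _)]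

theorem getD_gammaSeq_head {S : Word} (hS : 2 ≤ S.length) (k : ℕ) :
    (gammaSeq S k).getD 0 0 = S.getD (if Even k then 0 else 1) 0 ∧
      (gammaSeq S k).getD 1 0 = S.getD (if Even k then 1 else 0) 0 := by
  induction k with
  | zero => simp [gammaSeq]
  | succ k ih =>
    have hl := two_le_length_gammaSeq hS k
    simp only [gammaSeq, List.append_assoc]
    rw [List.getD_append _ _ _ _ (by rw [length_swap]; omega),
      List.getD_append _ _ _ _ (by rw [length_swap]; omega), getD_swap_zero (by omega),
      getD_swap_one (by omega), ih.1, ih.2]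
    rcases Nat.even_or_odd k with h | h
    · simp [h, Nat.even_add_one]
    · simp [Nat.not_even_iff_odd.2 h, Nat.even_add_one]

/-- `γ` at level `k + 1` consists of three copies of level `k`. Inside a copy the valuation of the
block index is unchanged, and the swap touches only the first two letters. The second and third
copies start at block indices of valuation `k`, where the head has been swapped `k` times. -/
theorem getD_gammaSeq {S : Word} (hS : 2 ≤ S.length) (k m : ℕ) (hm : 0 < m) (hmk : m < 3 ^ k) :
    (gammaSeq S k).getD (S.length * m) 0 =
      S.getD (if Even (padicValNat 3 m) then 0 else 1) 0 := by
  induction k generalizing m with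
  | zero => simp at hmk; omega
  | succ k ih =>
    have hl := length_gammaSeq S k
    have tail : ∀ c r : ℕ, c = 1 ∨ c = 2 → r < 3 ^ k → (gammaSeq S k).getD (S.length * r) 0 =
        S.getD (if Even (padicValNat 3 (c * 3 ^ k + r)) then 0 else 1) 0 := by
      intro c r hc hr
      rcases Nat.eq_zero_or_pos r with rfl | hr0
      · have : padicValNat 3 (c * 3 ^ k + 0) = k := by
          rw [add_zero, padicValNat.mul (by omega) (by positivity), padicValNat.prime_pow,
            padicValNat.eq_zero_of_not_dvd (by omega), zero_add]
        rw [this, mul_zero, (getD_gammaSeq_head hS k).1]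
      · rw [padicValNat_three_add hr0 hr, ih r hr0 hr]
    simp only [gammaSeq, List.append_assoc]
    rcases lt_or_ge m (3 ^ k) with h1 | h1
    · rw [List.getD_append _ _ _ _ (by rw [length_swap, hl]; gcongr),
        getD_swap (by nlinarith), ih m hm h1]
    · obtain ⟨r, rfl⟩ := Nat.exists_eq_add_of_le h1
      rw [List.getD_append_right _ _ _ _ (by rw [length_swap, hl]; gcongr), length_swap, hl,
        mul_add, Nat.add_sub_cancel_left]
      rcases lt_or_ge r (3 ^ k) with h2 | h2
      · rw [List.getD_append _ _ _ _ (by rw [hl]; gcongr), tail 1 r (by simp) h2, one_mul]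
      · obtain ⟨r, rfl⟩ := Nat.exists_eq_add_of_le h2
        rw [List.getD_append_right _ _ _ _ (by rw [hl]; gcongr), hl, mul_add,
          Nat.add_sub_cancel_left, tail 2 r (by simp) (by rw [pow_succ] at hmk; omega), two_mul,
          add_assoc]

section
variable {a b : ℕ} {S : Word} {P R c σ : ℤ} {Γ : InfWord}

theorem SeedData.P_pos (h : SeedData a b S P R c σ) : 0 < P := by
  have := h.c_pos
  have : 0 ≤ b * c := by positivity
  linarith [h.lt_P]

theorem SeedData.mul_P_le (h : SeedData a b S P R c σ) : a * P ≤ R := by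
  linarith [h.R_eq, h.c_pos]

theorem SeedData.c_lt (h : SeedData a b S P R c σ) : c < P := by
  have := h.c_pos
  have : 0 ≤ b * c := by positivity
  linarith [h.lt_P]

theorem SeedData.P_lt_R (h : SeedData a b S P R c σ) : P < R := by
  have := h.c_pos
  have := h.P_pos
  have : (1 : ℤ) ≤ a := by exact_mod_cast h.one_le
  nlinarith [h.R_eq]

theorem SeedData.two_le (h : SeedData a b S P R c σ) : 2 ≤ S.length := by
  have := h.P_lt_R
  have := h.P_pos
  have := h.length_eq
  omega

/-- Moving the start from `1/2` or `-1/2` to `0` violates no weak inequality at integer points. `S`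
begins with `01` or `10`, and both orders lead legally from `0` to `P - R`, through `P` or `-R`. -/
theorem SeedData.reads_zero (h : SeedData a b S P R c σ) :
    Reads P R 0 S ∧ Reads P R 0 (swap S) := by
  have h0 : Reads P R 0 S := by
    refine reads_iff.2 fun i hi => ?_
    have h1 := reads_iff.1 h.reads i hi
    rw [disp_double] at h1
    have h2 := h.sign
    constructor
    · intro h3; have := h1.1 h3; omega
    · intro h3; have := h1.2 h3; omega
  refine ⟨h0, ?_⟩
  have h1 := h.reads
  have h2 := h.two_le
  have hP := h.P_pos
  have hR := h.P_lt_R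
  have hσ := h.sign
  match S, h2 with
  | x :: y :: t, _ =>
    simp only [swap]
    obtain ⟨h3, h4, h5, h6, h7⟩ := h1
    obtain ⟨-, -, -, -, h8⟩ := h0
    rcases fin_two_cases x with rfl | rfl <;> rcases fin_two_cases y with rfl | rfl
    · simp at *; omega
    · refine ⟨by simp, by simp, by simp; omega, by simp, ?_⟩
      convert h8 using 1; simp; ring
    · refine ⟨by simp, by simp, by simp, by simp; omega, ?_⟩
      convert h8 using 1; simp; ring
    · simp at *; omega

theorem SeedData.disp_gammaSeq (h : SeedData a b S P R c σ) (k : ℕ) :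
    disp P R (gammaSeq S k) = 0 := by
  induction k with
  | zero => exact h.disp_eq_zero
  | succ k ih => simp [gammaSeq, disp_swap, ih]

theorem SeedData.reads_gammaSeq (h : SeedData a b S P R c σ) (k : ℕ) :
    Reads P R 0 (gammaSeq S k) ∧ Reads P R 0 (swap (gammaSeq S k)) := by
  induction k with
  | zero => exact h.reads_zero
  | succ k ih =>
    have hd := h.disp_gammaSeq k
    have hl := two_le_length_gammaSeq h.two_le k
    simp only [gammaSeq, List.append_assoc]
    rw [swap_swap_append (by omega)]
    simp [reads_append, disp_swap, hd, ih.1, ih.2]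

theorem SeedData.infReads_gamma (h : SeedData a b S P R c σ) (hΓ : IsGamma S Γ) :
    InfReads P R 0 Γ := by
  obtain ⟨e, he⟩ := hΓ.exists_isPrefix h.two_le
  intro n
  refine (h.reads_gammaSeq (2 * n + e)).1.of_prefix ?_
  have hl := two_le_length_gammaSeq h.two_le (2 * n + e)
  rw [← he n]
  obtain ⟨m, hm⟩ := Nat.exists_eq_add_of_le (show n ≤ (gammaSeq S (2 * n + e)).length by omega)
  rw [hm, factor_add]
  exact List.prefix_append _ _

theorem IsGamma.letter (hΓ : IsGamma S Γ) (hS : 2 ≤ S.length) {m : ℕ} (hm : 0 < m) :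
    Γ (S.length * m) = S.getD (if Even (padicValNat 3 m) then 0 else 1) 0 := by
  obtain ⟨e, he⟩ := hΓ.exists_isPrefix hS
  have hmk : m < 3 ^ (2 * m + e) :=
    lt_of_le_of_lt (by omega) (Nat.lt_pow_self (n := 2 * m + e) (by norm_num))
  have hlt : S.length * m < (gammaSeq S (2 * m + e)).length := by
    rw [length_gammaSeq]; gcongr
  rw [← getD_gammaSeq hS _ m hm hmk, isPrefix_iff.1 (he m) _ hlt, List.getD_eq_getElem _ _ hlt]

theorem IsGamma.letter_two_mul (hΓ : IsGamma S Γ) (hS : 2 ≤ S.length) (m : ℕ) :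
    Γ (S.length * (2 * m)) = Γ (S.length * m) := by
  rcases Nat.eq_zero_or_pos m with rfl | hm
  · rfl
  · rw [hΓ.letter hS hm, hΓ.letter hS (by omega), padicValNat.mul (by norm_num) hm.ne',
      padicValNat.eq_zero_of_not_dvd (by norm_num), zero_add]

/-- Applying `L` twice cancels, so `Γ` begins with `γγ` for arbitrarily long `γ` of length `|S| *
3^n`. The oddness of `3^n` permits the parity correction in `OccursAt.exists_even`. -/
theorem IsGamma.recurrent (hΓ : IsGamma S Γ) (hS : 2 ≤ S.length) (N : ℕ) :
    ∃ M, Odd M ∧ ∀ j < N, Γ (S.length * M + j) = Γ j := by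
  obtain ⟨e, he⟩ := hΓ.exists_isPrefix hS
  have hl := two_le_length_gammaSeq hS (2 * N + e)
  have h1 := he (N + 1)
  rw [show 2 * (N + 1) + e = 2 * N + e + 1 + 1 by ring, gammaSeq, gammaSeq] at h1
  simp only [List.append_assoc] at h1
  rw [swap_swap_append (by omega)] at h1
  have h1 := (isPrefix_append.1 h1).1
  rw [isPrefix_append, isPrefix_append] at h1
  refine ⟨3 ^ (2 * N + e), Odd.pow (by decide), fun j hj => ?_⟩
  have h2 := isPrefix_iff.1 h1.1 j (by omega)
  have h3 := isPrefix_iff.1 h1.2.1 j (by omega)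
  rw [← length_gammaSeq S, h2]
  exact h3

theorem mem_subshift_iff {w : InfWord} :
    w ∈ subshift Γ ↔ ∀ n, ∃ i, ∀ j < n, w j = Γ (i + j) := by
  constructor
  · intro h n
    obtain ⟨i, hi⟩ := h (show factor w 0 n ∈ language w from ⟨0, by simp⟩)
    refine ⟨i, fun j hj => ?_⟩
    rw [length_factor] at hi
    simpa using (factor_eq_iff.1 hi j hj).symm
  · rintro h u ⟨i, hi⟩
    obtain ⟨k, hk⟩ := h (i + u.length)
    refine ⟨k + i, ?_⟩
    conv_rhs => rw [← hi]
    refine factor_congr fun j hj => ?_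
    rw [hk (i + j) (by omega), add_assoc]

end

/-! ### Words of the subshift and their square roots -/

/-- Every prefix of `w` occurs in `Γ` at a position with state `z`. -/
def OccursAt (P R : ℤ) (Γ w : InfWord) (z : ℤ) : Prop :=
  ∀ n, ∃ i, disp P R (factor Γ 0 i) = z ∧ ∀ j < n, w j = Γ (i + j)

section
variable {a b : ℕ} {S : Word} {P R c σ z : ℤ} {Γ w r : InfWord}

theorem OccursAt.mem_subshift (h : OccursAt P R Γ w z) : w ∈ subshift Γ :=
  mem_subshift_iff.2 fun n => let ⟨i, _, hi⟩ := h n; ⟨i, hi⟩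

theorem occursAt_shift (Γ : InfWord) (i : ℕ) :
    OccursAt P R Γ (shift i Γ) (disp P R (factor Γ 0 i)) :=
  fun _ => ⟨i, rfl, fun _ _ => rfl⟩

theorem SeedData.state_mem (h : SeedData a b S P R c σ) (hΓ : IsGamma S Γ) (i : ℕ) :
    -R ≤ disp P R (factor Γ 0 i) ∧ disp P R (factor Γ 0 i) ≤ P := by
  have hP := h.P_pos
  have hR := h.P_lt_R
  simpa using (h.infReads_gamma hΓ i).mem_range (by omega) hP.le hP.le (by omega)

theorem OccursAt.mem_range (hw : OccursAt P R Γ w z) (h : SeedData a b S P R c σ)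
    (hΓ : IsGamma S Γ) : -R ≤ z ∧ z ≤ P := by
  obtain ⟨i, rfl, -⟩ := hw 0
  exact h.state_mem hΓ i

/-- There are finitely many states, so if each failed for some prefix length, the maximum of these
lengths would fail for all. -/
theorem SeedData.exists_occursAt (h : SeedData a b S P R c σ) (hΓ : IsGamma S Γ)
    (hw : w ∈ subshift Γ) : ∃ z, OccursAt P R Γ w z := by
  by_contra hcon
  have : ∀ z, ∃ n, ∀ i, disp P R (factor Γ 0 i) = z → ¬ ∀ j < n, w j = Γ (i + j) := by
    intro z
    by_contra hz
    refine hcon ⟨z, fun n => ?_⟩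
    by_contra hn
    exact hz ⟨n, fun i hi hj => hn ⟨i, hi, hj⟩⟩
  choose f hf using this
  obtain ⟨i, hi⟩ := mem_subshift_iff.1 hw ((Finset.Icc (-R) P).sup f)
  refine hf _ i rfl fun j hj => hi j (hj.trans_le ?_)
  exact Finset.le_sup (f := f) (Finset.mem_Icc.2 (h.state_mem hΓ i))

theorem OccursAt.infReads (hw : OccursAt P R Γ w z) (h : SeedData a b S P R c σ)
    (hΓ : IsGamma S Γ) : InfReads P R z w := by
  intro n
  obtain ⟨i, hi, hn⟩ := hw n
  have := (h.infReads_gamma hΓ).suffix i n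
  rwa [zero_add, hi, factor_shift, add_zero,
    ← factor_congr (v := w) (i := 0) fun k hk => by simpa using hn k hk] at this

theorem OccursAt.exists_isSqrt (hw : OccursAt P R Γ w z) (h : SeedData a b S P R c σ)
    (hΓ : IsGamma S Γ) : ∃ r, IsSqrt a b w r :=
  have hz := hw.mem_range h hΓ
  (hw.infReads h hΓ).exists_isSqrt h.R_eq h.one_le h.c_pos h.lt_P h.P_lt hz.1 hz.2

theorem OccursAt.infReads_sqrt (hw : OccursAt P R Γ w z) (h : SeedData a b S P R c σ)
    (hΓ : IsGamma S Γ) (hr : IsSqrt a b w r) : InfReads (2 * P) (2 * R) z r :=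
  hr.infReads (hw.infReads h hΓ) h.one_le h.P_pos h.mul_P_le (by linarith [h.R_eq, h.c_lt])

/-- A word of `Ω` with even state occurs in `Γ` at even positions `2 k` such that the state of `Γ`
at `k` is half of that of the word. -/
theorem OccursAt.exists_even (hw : OccursAt P R Γ w z) (h : SeedData a b S P R c σ)
    (hΓ : IsGamma S Γ) (hz : Even z) (n : ℕ) :
    ∃ k, 2 * disp P R (factor Γ 0 k) = z ∧ ∀ j < n, w j = Γ (2 * k + j) := by
  have hP := h.P_pos
  have hPR := h.P_lt_R
  have hq := h.length_eq
  obtain ⟨i, hi, hij⟩ := hw n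
  obtain ⟨M, hM, hrec⟩ := hΓ.recurrent h.two_le (i + n)
  have hm := disp_modEq (P := P) (R := R) (factor Γ 0 i)
  rw [hi, length_factor] at hm
  obtain ⟨t, ht⟩ := Int.modEq_iff_dvd.1 hm
  have hco : ¬ (Even (P + R) ∧ Even P) := by
    rintro ⟨h1, h2⟩
    have := h.coprime.isUnit_of_dvd' h1.two_dvd h2.two_dvd
    revert this; decide
  -- Write `P * i - z = (P + R) * t`. Passing from `i` to `|S| * M + i` adds `P * M` to `t`. If `P`
  -- is even then `|S|` is odd and `t` is even, and the shift can correct the parity of `i`; if `P`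
  -- is odd, the shift can correct the parity of `t`, and then `i'` is even automatically.
  have key : ∃ i' : ℕ, Even i' ∧ (2 * (P + R)) ∣ P * i' - z ∧ ∀ j < n, w j = Γ (i' + j) := by
    have hrec' : ∀ j < n, w j = Γ (S.length * M + i + j) := by
      intro j hj
      rw [hij j hj, add_assoc, hrec _ (by omega)]
    have hdvd : Even t → (2 * (P + R)) ∣ P * i - z := by
      rintro ⟨s, rfl⟩
      exact ⟨s, by rw [ht]; ring⟩
    have hdvd' : Even (t + P * M) → (2 * (P + R)) ∣ P * (S.length * M + i : ℕ) - z := by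
      rintro ⟨s, hs⟩
      refine ⟨s, ?_⟩
      push_cast
      rw [hq]
      linear_combination ht + (P + R) * hs
    rcases Int.even_or_odd P with hPe | hPo
    · have hqo : Odd (P + R) := Int.not_even_iff_odd.1 fun h1 => hco ⟨h1, hPe⟩
      have hSo : Odd S.length := by rw [← hq] at hqo; exact_mod_cast hqo
      have hte : Even t := by
        have : Even ((P + R) * t) := by rw [← ht]; exact (hPe.mul_right _).sub hz
        exact (Int.even_mul.1 this).resolve_left (Int.not_even_iff_odd.2 hqo)
      rcases Nat.even_or_odd i with hie | hio
      · exact ⟨i, hie, hdvd hte, hij⟩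
      · exact ⟨S.length * M + i, (hSo.mul hM).add_odd hio, hdvd' (hte.add (hPe.mul_right _)), hrec'⟩
    · have heven : ∀ i' : ℕ, (2 * (P + R)) ∣ P * i' - z → Even i' := by
        intro i' hi'
        have h1 : Even (P * i' - z) := even_iff_two_dvd.2 ((dvd_mul_right _ _).trans hi')
        have h2 : Even (P * i') := by simpa using h1.add hz
        have := (Int.even_mul.1 h2).resolve_left (Int.not_even_iff_odd.2 hPo)
        exact_mod_cast this
      rcases Int.even_or_odd t with hte | hto
      · exact ⟨i, heven i (hdvd hte), hdvd hte, hij⟩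
      · have hMo : Odd (M : ℤ) := by exact_mod_cast hM
        have h1 := hdvd' (hto.add_odd (hPo.mul hMo))
        exact ⟨S.length * M + i, heven _ h1, h1, hrec'⟩
  obtain ⟨i', hi', hd, hij'⟩ := key
  obtain ⟨k, rfl⟩ := hi'
  refine ⟨k, ?_, by simpa [two_mul] using hij'⟩
  have h1 := h.state_mem hΓ k
  have h2 := hw.mem_range h hΓ
  have h3 := disp_modEq (P := P) (R := R) (factor Γ 0 k)
  rw [length_factor] at h3
  obtain ⟨s, hs⟩ := Int.modEq_iff_dvd.1 h3
  obtain ⟨s', hs'⟩ := hd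
  push_cast at hs'
  have h4 : 2 * (P + R) ∣ 2 * disp P R (factor Γ 0 k) - z := ⟨s' - s, by linarith⟩
  have := Int.eq_zero_of_abs_lt_dvd h4 (abs_lt.2 ⟨by linarith, by linarith⟩)
  linarith

theorem OccursAt.sqrt_mem_subshift (hw : OccursAt P R Γ w z) (h : SeedData a b S P R c σ)
    (hΓ : IsGamma S Γ) (hz : Even z) (hr : IsSqrt a b w r) : r ∈ subshift Γ := by
  have hP := h.P_pos
  have hq := h.length_eq
  rw [mem_subshift_iff]
  intro n
  obtain ⟨k, hk, hkn⟩ := hw.exists_even h hΓ hz (2 * n)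
  have hr2 := hw.infReads_sqrt h hΓ hr
  have hΓ2 := h.infReads_gamma hΓ
  refine ⟨k, fun l hl => ?_⟩
  induction l using Nat.strong_induction_on with
  | _ l ih =>
    have e : factor r 0 l = factor Γ k l :=
      factor_congr fun j hj => by simpa using ih j hj (hj.trans hl)
    have h1 := hr2.letter l
    have h2 := hΓ2.letter (k + l)
    rw [factor_add, zero_add, disp_append, zero_add] at h2
    have h3 : z + disp (2 * P) (2 * R) (factor r 0 l) =
        2 * (disp P R (factor Γ 0 k) + disp P R (factor Γ k l)) := by
      rw [e, disp_double, ← hk]; ring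
    -- Off `0` the common state forces the same letter. At `0` the position `k + l` is a multiple
    -- `|S| * m`, and `r l = w (2l) = Γ (2(k + l)) = Γ (k + l)`.
    rcases eq_or_ne (disp P R (factor Γ 0 k) + disp P R (factor Γ k l)) 0 with h0 | h0
    · have h4 := hr.letter_of_disp_eq_zero (hw.infReads h hΓ) h.one_le hP h.mul_P_le
        (by linarith [h.R_eq, h.c_lt]) h.coprime (by rw [← hq]; exact_mod_cast h.root_lt)
        (l := l) (by rw [h3, h0, mul_zero])
      have h5 := disp_modEq (P := P) (R := R) (factor Γ 0 (k + l))
      rw [length_factor, factor_add, zero_add, disp_append, h0] at h5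
      have h6 : S.length ∣ k + l := by
        have := h.coprime.dvd_of_dvd_mul_left (Int.modEq_zero_iff_dvd.1 h5.symm)
        rw [← hq] at this
        exact_mod_cast this
      obtain ⟨m, hm⟩ := h6
      rw [h4, hkn _ (by omega), ← mul_add, hm, mul_left_comm, hΓ.letter_two_mul h.two_le]
    · rw [h3] at h1
      rcases fin_two_cases (r l) with h4 | h4 <;> rcases fin_two_cases (Γ (k + l)) with h5 | h5
      · rw [h4, h5]
      · have := h1.1 h4
        have := h2.2 h5
        omega
      · have := h1.2 h4
        have := h2.1 h5
        omega
      · rw [h4, h5]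

theorem SeedData.cyc_eq_one_iff (h : SeedData a b S P R c σ) (n : ℕ) :
    cyc S n = 1 ↔ (σ + 2 * (P * n)) % (2 * (P + R)) < 2 * P := by
  have hP := h.P_pos
  have hPR := h.P_lt_R
  have hS := h.two_le
  have hσ := h.sign
  have hn : n % S.length < S.length := Nat.mod_lt _ (by omega)
  have h1 := h.reads.letter_odd (by rcases hσ with rfl | rfl <;> decide) (by omega) (by omega)
    hP.le (by omega) _ hn
  rw [cyc, List.getD_eq_getElem _ _ hn, h1]
  have e : σ + 2 * (P * (n % S.length : ℕ)) ≡ σ + 2 * (P * n) [ZMOD 2 * (P + R)] := by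
    refine Int.ModEq.add_left _ (Int.ModEq.mul_left' (Int.ModEq.mul_left _ ?_))
    rw [← h.length_eq]
    push_cast
    exact Int.mod_modEq _ _
  rw [e]

/-- The root and `S^ω` are codings of the same rotation on odd points, so they differ by the time
`t` with `P * t ≡ (z - σ) / 2` modulo `P + R`. -/
theorem OccursAt.exists_sqrt_eq_cyc (hw : OccursAt P R Γ w z) (h : SeedData a b S P R c σ)
    (hΓ : IsGamma S Γ) (hz : Odd z) (hr : IsSqrt a b w r) : ∃ t, ∀ n, r n = cyc S (t + n) := by
  have hP := h.P_pos
  have hPR := h.P_lt_R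
  have hσ : Odd σ := by rcases h.sign with h | h <;> rw [h] <;> decide
  obtain ⟨k, hk⟩ := hz.sub_odd hσ
  obtain ⟨t, -, ht⟩ := exists_mul_modEq h.coprime (by omega) k
  refine ⟨t, fun n => ?_⟩
  have hzr := hw.mem_range h hΓ
  have h1 := (hw.infReads_sqrt h hΓ hr).letter_odd hz (by omega) (by omega) hP.le (by omega) n
  have h2 := h.cyc_eq_one_iff (t + n)
  have e : z + 2 * (P * n) ≡ σ + 2 * (P * (t + n : ℕ)) [ZMOD 2 * (P + R)] := by
    have e1 : z + 2 * (P * n) = (σ + 2 * (P * n)) + 2 * k := by linarith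
    have e2 : σ + 2 * (P * (t + n : ℕ)) = (σ + 2 * (P * n)) + 2 * (P * t) := by push_cast; ring
    rw [e1, e2]
    exact Int.ModEq.add_left _ (Int.ModEq.mul_left' ht.symm)
  rw [e, ← h2] at h1
  rcases fin_two_cases (r n) with h3 | h3 <;> rcases fin_two_cases (cyc S (t + n)) with h4 | h4
  · rw [h3, h4]
  · rw [h1.2 h4, h4]
  · rw [h3, h1.1 h3]
  · rw [h3, h4]

end

/-! ### Minimal periods -/

theorem wordPow_cons_append (x : Fin 2) (u : Word) (n : ℕ) :
    wordPow (x :: u) n ++ [x] = x :: wordPow (u ++ [x]) n := by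
  induction n with
  | zero => simp [wordPow_zero]
  | succ n ih => rw [wordPow_succ, List.append_assoc, ih, wordPow_succ]; simp

theorem exists_rotate_wordPow (u : Word) (n k : ℕ) :
    ∃ v, (wordPow u n).rotate k = wordPow v n := by
  induction k with
  | zero => exact ⟨u, by simp⟩
  | succ k ih =>
    obtain ⟨v, hv⟩ := ih
    rw [← List.rotate_rotate, hv]
    rcases n with _ | n
    · exact ⟨[], by simp [wordPow_zero]⟩
    rcases v with _ | ⟨x, v⟩
    · exact ⟨[], by simp [wordPow]⟩
    · refine ⟨v ++ [x], ?_⟩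
      rw [wordPow_succ, wordPow_succ, List.cons_append, List.rotate_cons_succ, List.rotate_zero,
        List.append_assoc, wordPow_cons_append]
      simp

/-- Rotating an `n`-th power gives an `n`-th power. -/
theorem Primitive.rotate {S : Word} (h : Primitive S) (k : ℕ) : Primitive (S.rotate k) := by
  intro u n hn
  obtain ⟨k', hk'⟩ : S.rotate k ~r S := List.IsRotated.forall S k
  obtain ⟨v, hv⟩ := exists_rotate_wordPow u n k'
  exact h v n (by rw [← hv, ← hn, hk'])

theorem partialProd_const (v : Word) (k : ℕ) : partialProd (fun _ => v) k = wordPow v k := by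
  induction k with
  | zero => simp [wordPow_zero]
  | succ k ih => rw [partialProd_succ, ih, wordPow_succ']

theorem isMinimalPeriod_of_eq_cyc {S : Word} {r : InfWord} {t : ℕ} (hS : Primitive S) (h0 : S ≠ [])
    (h : ∀ n, r n = cyc S (t + n)) : IsMinimalPeriod r (S.rotate t) := by
  refine ⟨S.rotate t, isInfProd_of_isPrefix_shift (fun _ => by simpa using h0) fun k => ?_,
    hS.rotate t, 1, le_rfl, by simp [wordPow]⟩
  rw [partialProd_const, length_wordPow, isPrefix_iff]
  intro i hi
  have hl := List.length_pos_of_ne_nil h0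
  have e : (t + (k * (S.rotate t).length + i)) % S.length = (i + t) % S.length := by
    rw [List.length_rotate, show t + (k * S.length + i) = i + t + S.length * k by ring,
      Nat.add_mul_mod_self_left]
  rw [shift_apply, h, List.getElem_rotate, cyc, e, List.getD_eq_getElem _ _ (Nat.mod_lt _ hl)]

theorem IsMinimalPeriod.add_length {r : InfWord} {z : Word} (h : IsMinimalPeriod r z) (n : ℕ) :
    r (n + z.length) = r n := by
  obtain ⟨v, hv, -, m, hm, rfl⟩ := h
  have key : ∀ n, r n = cyc z n := by
    intro n
    have h1 := le_length_partialProd hv.1 (n + 1)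
    have h2 := isPrefix_iff.1 (hv.isPrefix (n + 1)) n (by omega)
    have hpos := List.length_pos_of_ne_nil (hv.1 0)
    rw [h2, ← List.getD_eq_getElem _ 0]
    rw [partialProd_const] at h1 ⊢
    rw [length_wordPow] at h1
    rw [getD_wordPow _ _ _ (by omega), getD_wordPow, length_wordPow, cyc,
      Nat.mod_mod_of_dvd _ (dvd_mul_left _ _)]
    rw [length_wordPow] at hpos ⊢
    exact Nat.mod_lt _ hpos
  rw [key, key, cyc_add_length]

section
variable {a b : ℕ} {S : Word} {P R c σ z : ℤ} {Γ w r : InfWord}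

theorem SeedData.getD_ne (h : SeedData a b S P R c σ) : S.getD 0 0 ≠ S.getD 1 0 := by
  have h1 := h.reads
  have h2 := h.two_le
  have hP := h.P_pos
  have hR := h.P_lt_R
  have hσ := h.sign
  match S, h2 with
  | x :: y :: t, _ =>
    obtain ⟨h3, h4, h5, h6, -⟩ := h1
    rcases fin_two_cases x with rfl | rfl <;> rcases fin_two_cases y with rfl | rfl
    · simp at *; omega
    · simp
    · simp
    · simp at *; omega

/-- Block indices `9k + 1` and `9k + 3` have 3-adic valuations `0` and `1`, so `Γ` has different
letters at the corresponding positions, which are `2|S|` apart. -/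
theorem SeedData.not_periodic (h : SeedData a b S P R c σ) (hΓ : IsGamma S Γ)
    (hr : r ∈ subshift Γ) (hper : ∀ n, r (n + S.length) = r n) : False := by
  have hS := h.two_le
  obtain ⟨i, hi⟩ := mem_subshift_iff.1 hr (20 * S.length)
  -- The first block index of the form `9k + 1` with `k ≥ 1` safely beyond `i`; it is at most ten
  -- blocks away, so a window of `20` blocks contains it and the block two later.
  set k := i / S.length / 9 + 1 with hk
  have hdiv := Nat.div_add_mod i S.length
  have hmod := Nat.mod_lt i (show 0 < S.length by omega)
  have hk1 : i / S.length + 1 ≤ 9 * k + 1 := by omega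
  have hk2 : 9 * k + 1 ≤ i / S.length + 10 := by omega
  have e1 := Nat.mul_le_mul_left S.length hk1
  have e2 := Nat.mul_le_mul_left S.length hk2
  rw [mul_add, mul_one] at e1
  rw [mul_add S.length (i / S.length)] at e2
  obtain ⟨j, hj⟩ := Nat.exists_eq_add_of_le (show i ≤ S.length * (9 * k + 1) by omega)
  have hj20 : j + S.length + S.length < 20 * S.length := by omega
  have h1 := hi j (by omega)
  have h2 := hi (j + S.length + S.length) hj20
  rw [← hj, hΓ.letter hS (by omega)] at h1
  rw [show i + (j + S.length + S.length) = S.length * (k * 3 ^ 2 + 3) by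
      rw [← add_assoc, ← add_assoc, ← hj]; ring, hΓ.letter hS (by omega), hper, hper, h1,
    padicValNat_three_add (by norm_num) (by norm_num), show 9 * k + 1 = k * 3 ^ 2 + 1 by ring,
    padicValNat_three_add (by norm_num) (by norm_num)] at h2
  exact h.getD_ne (by simpa using h2)

theorem OccursAt.sqrt_isMinimalPeriod (hw : OccursAt P R Γ w z) (h : SeedData a b S P R c σ)
    (hΓ : IsGamma S Γ) (hz : Odd z) (hr : IsSqrt a b w r) :
    ∃ v, IsMinimalPeriod r v ∧ v ~r S := by
  obtain ⟨t, ht⟩ := hw.exists_sqrt_eq_cyc h hΓ hz hr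
  have hS := h.two_le
  exact ⟨S.rotate t, isMinimalPeriod_of_eq_cyc h.primitive (by rintro rfl; simp at hS) ht,
    List.IsRotated.forall S t⟩

theorem SeedData.not_mem_and_isMinimalPeriod (h : SeedData a b S P R c σ) (hΓ : IsGamma S Γ) :
    ¬ (r ∈ subshift Γ ∧ ∃ v, IsMinimalPeriod r v ∧ v ~r S) := by
  rintro ⟨hr, v, hv, hvS⟩
  exact h.not_periodic hΓ hr fun n => by rw [← hvS.perm.length_eq]; exact hv.add_length n

theorem SeedData.exists_state_eq_neg_one (h : SeedData a b S P R c σ) (hΓ : IsGamma S Γ) :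
    ∃ i, disp P R (factor Γ 0 i) = -1 := by
  have hP := h.P_pos
  have hPR := h.P_lt_R
  obtain ⟨i, -, hi⟩ := exists_mul_modEq h.coprime (by omega) (-1)
  have h1 := disp_modEq (P := P) (R := R) (factor Γ 0 i)
  rw [length_factor] at h1
  have h2 := h.state_mem hΓ i
  have := Int.eq_zero_of_abs_lt_dvd (Int.modEq_iff_dvd.1 (h1.trans hi))
    (abs_lt.2 ⟨by omega, by omega⟩)
  exact ⟨i, by omega⟩

end

end SquareRootMap

theorem theorem8p6 (a b : ℕ) (ha : 1 ≤ a) (S : SquareRootMap.Word)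
    (hS : SquareRootMap.IsSeed a b S) (Γ : SquareRootMap.InfWord)
    (hΓ : SquareRootMap.IsGamma S Γ) :
    (∀ w ∈ SquareRootMap.subshift Γ,
      (∃! r, SquareRootMap.IsSqrt a b w r) ∧
      ∀ r, SquareRootMap.IsSqrt a b w r →
        Xor (r ∈ SquareRootMap.subshift Γ)
          (∃ z, SquareRootMap.IsMinimalPeriod r z ∧ z ~r S)) ∧
    (∃ u ∈ SquareRootMap.subshift Γ, ∃ r, SquareRootMap.IsSqrt a b u r ∧
      r ∈ SquareRootMap.subshift Γ) ∧
    (∃ v ∈ SquareRootMap.subshift Γ, ∃ r, SquareRootMap.IsSqrt a b v r ∧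
      ∃ z, SquareRootMap.IsMinimalPeriod r z ∧ z ~r S) := by
  obtain ⟨P, R, c, σ, h⟩ := hS.exists_seedData ha
  refine ⟨fun w hw => ?_, ?_, ?_⟩
  · obtain ⟨z, hz⟩ := h.exists_occursAt hΓ hw
    obtain ⟨r, hr⟩ := hz.exists_isSqrt h hΓ
    refine ⟨⟨r, hr, fun r' hr' => hr'.unique ha hr⟩, fun r' hr' => ?_⟩
    have hnot := h.not_mem_and_isMinimalPeriod (r := r') hΓ
    rcases Int.even_or_odd z with he | ho
    · have hmem := hz.sqrt_mem_subshift h hΓ he hr'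
      exact Or.inl ⟨hmem, fun hp => hnot ⟨hmem, hp⟩⟩
    · have hp := hz.sqrt_isMinimalPeriod h hΓ ho hr'
      exact Or.inr ⟨hp, fun hmem => hnot ⟨hmem, hp⟩⟩
  -- `Γ` itself has the even state `0`.
  · have hz := SquareRootMap.occursAt_shift (P := P) (R := R) Γ 0
    obtain ⟨r, hr⟩ := hz.exists_isSqrt h hΓ
    exact ⟨_, hz.mem_subshift, r, hr, hz.sqrt_mem_subshift h hΓ (by simp [SquareRootMap.factor]) hr⟩
  -- A suffix of `Γ` starting at the odd state `-1`.
  · obtain ⟨i, hi⟩ := h.exists_state_eq_neg_one hΓ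
    have hz := SquareRootMap.occursAt_shift (P := P) (R := R) Γ i
    obtain ⟨r, hr⟩ := hz.exists_isSqrt h hΓ
    exact ⟨_, hz.mem_subshift, r, hr, hz.sqrt_isMinimalPeriod h hΓ (by rw [hi]; decide) hr⟩
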